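/- **Setting.** The state space $\mathcal X$ and the control space $\mathcal U$ are Borel subsets of Polish spaces. $U:\mathcal X\rightrightarrows\mathcal U$ is a measurable multifunction with nonempty values, $Q$ is a stochastic kernel from $\operatorname{graph}(U)$ to $\mathcal X$, and $c:\mathcal X\times\mathcal U\times\mathcal X\to\mathbb R$ is the transition cost. The state $x_{\rm A}$ is absorbing: $Q(\{x_{\rm A}\}|x_{\rm A},u)=1$ and $c(x_{\rm A},u,x_{\rm A})=0$ for all $u\in U(x_{\rm A})$. Let $P_0$ be a probability measure on $\mathcal X$, $p\in[1,\infty)$, $1/p+1/q=1$, $\mathcal V=L_p(\mathcal X,P_0)$, $\langle\varphi,\mu\rangle=\int\varphi\,d\mu$, and let $\mathcal M$ be the set of probability measures $m\ll P_0$ with $dm/dP_0\in L_q(P_0)$, with the weak$^*$ topology (that of the pairing with $\mathcal V$). Let $w:\mathcal X\to[1,\infty)$ be measurable with $w\in\mathcal V$; a function $v$ is $w$-bounded if $|v|\le C w$ for some constant $C$. Let $\sigma:\mathcal V\times\mathcal X\times\mathcal M\to\mathbb R$ be a law invariant risk transition mapping, that is: - $\sigma$ is measurable; - each $\sigma(\cdot,x,m)$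 is a coherent measure of risk (convex, monotone, positively homogeneous, and $\sigma(a+\varphi,x,m)=a+\sigma(\varphi,x,m)$ for $a\in\mathbb R$); - $\sigma(\varphi,x,\mu)=\sigma(\psi,x,\nu)$ whenever $\varphi$ has under $\mu$ the same distribution function as $\psi$ under $\nu$. Let $\mathcal A(x,m)\subset\mathcal M$ be the subdifferential of $\sigma(\cdot,x,m)$ at $0$. Assume: - **(G0)** $Q(x,u)\in\mathcal M$ for all $x$ and all $u\in U(x)$; - **(G1)** $(x,u)\mapsto\int v(y)\,Q(dy|x,u)$ is continuous on $\operatorname{graph}(U)$ for every $v\in\mathcal V$; - **(G2)** the multifunction $\mathcal A$ is lower semicontinuous on $\mathcal X\times\mathcal M$; - **(G3)** $c$ is measurable, $|c(x,u,y)|\le C(w(x)+w(y))$ for $u\in U(x)$ and some constant $C$, and $c(\cdot,\cdot,y)$ is lower semicontinuous for all $y$; - **(G4)** the sets $U(x)$ are compact. Assume also that the model is *uniformly risk-transient*, in the following sense. Put $\widetilde{\mathcal X}=\mathcal X\setminus\{x_{\rm A}\}$. For a measurable selector $\pi$ of $U$ and $x\in\widetilde{\mathcal X}$, let $\widetilde{\mathfrak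 M}^\pi(x)$ be the set of restrictions to $\widetilde{\mathcal X}$ of the measures in $\mathcal A(x,Q(x,\pi(x)))$. The composition of two set-valued kernels consists, at each point, of the values of the compositions $M_1M_2$ of their measurable (kernel) selectors; sums are Minkowski sums. Then there is a constant $K$ such that, for all $\pi$, all $T\ge 0$, and all measurable selectors $M$ of $\sum_{j=1}^T(\widetilde{\mathfrak M}^\pi)^j$, $$\sup_{x\in\widetilde{\mathcal X}}\frac1{w(x)}\int_{\widetilde{\mathcal X}}w(y)\,M(dy|x)\le K .$$ **Values.** A deterministic policy $\Lambda=\{\lambda_1,\lambda_2,\dots\}$ is a sequence of measurable maps from histories $h_t=(x_1,u_1,\dots,x_{t-1},u_{t-1},x_t)$ (with $u_s\in U(x_s)$) to controls $\lambda_t(h_t)\in U(x_t)$; it is Markov if each $\lambda_t$ depends on $x_t$ only. Its nested risk is $$J_T(\Lambda,x_1)=\rho_1\big(c(x_1,u_1,x_2)+\rho_2(c(x_2,u_2,x_3)+\cdots+\rho_T(c(x_T,u_T,x_{T+1}))\cdots)\big),\qquad u_t=\lambda_t(h_t),$$ where $\rho_t(Z)(h_t)=\sigma\big(Z(h_t,u_t,\cdot),x_t,Q(x_t,u_t)\big)$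 for functions $Z$ of $h_{t+1}$. Put $J_\infty(\Lambda,x)=\liminf_{T\to\infty}J_T(\Lambda,x)$ and $\hat J(x)=\inf_\Lambda J_\infty(\Lambda,x)$ (extended real values), where $\Lambda$ ranges over all deterministic policies; the theorem holds equally if, throughout, $\Lambda$ ranges over all deterministic Markov policies only. **Theorem.** Assume additionally that $\hat J$ is measurable and that there is a constant $C$ with $J_\infty(\Lambda,x)\ge -Cw(x)$ for all $x\in\mathcal X$ and all policies $\Lambda$. Then a $w$-bounded function $v\in\mathcal V$ satisfies $$v(x)=\inf_{u\in U(x)}\sigma\big(c(x,u,\cdot)+v(\cdot),x,Q(x,u)\big)\quad (x\in\mathcal X),\qquad v(x_{\rm A})=0,$$ if and only if $v(x)=\hat J(x)$ for all $x\in\mathcal X$; and $\hat J$ is such a function. Moreover, there is a measurable selector $\pi^*$ of $U$ such that $\pi^*(x)$ attains the infimum in this equation (with $v=\hat J$) for all $x\in\mathcal X$, and every such $\pi^*$ defines an optimal stationary deterministic Markov policy $\Pi^*=\{\pi^*,\pi^*,\dots\}$: $J_\infty(\Pi^*,x)=\lim_{T\to\infty}J_T(\Pi^*,x)=\hat J(x)$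 for all $x\in\mathcal X$. -/

import Mathlib

open MeasureTheory ProbabilityTheory Filter Topology
open scoped ENNReal NNReal

noncomputable section

/-! ### The controlled Markov model -/

/-- A stationary controlled Markov model with an absorbing state.  The multifunction `U` of admissible
controls is nonempty-valued and measurable (inverse images of open sets are measurable), and the
controlled kernel `Q` is a stochastic kernel on the graph of `U`. -/
structure ControlledModel (X A : Type*) [MeasurableSpace X] [TopologicalSpace A]
    [MeasurableSpace A] where
  /-- the control sets -/
  U : X → Set A
  U_nonempty : ∀ x, (U x).Nonempty
  U_measurable : ∀ O : Set A, IsOpen O → MeasurableSet {x | (U x ∩ O).Nonempty}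
  /-- the controlled transition kernel -/
  Q : Kernel {z : X × A // z.2 ∈ U z.1} X
  Q_markov : IsMarkovKernel Q
  /-- the cost of the transition from the first to the last argument -/
  c : X → A → X → ℝ
  /-- the absorbing state -/
  xA : X
  absorbing : ∀ (u : A) (hu : u ∈ U xA), Q ⟨(xA, u), hu⟩ {xA} = 1
  cost_absorbing : ∀ u ∈ U xA, c xA u xA = 0

/-! ### The space of test functions, its dual, and risk transition mappings -/

/-- The set `𝓜` of probability measures that are absolutely continuous with respect to `P0`, with a
density in `L_q(P0)`, where `1/p + 1/q = 1`. -/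
structure DualProb {X : Type*} [MeasurableSpace X] (p : ℝ≥0∞) (P0 : Measure X) where
  toMeasure : Measure X
  isProb : IsProbabilityMeasure toMeasure
  ac : toMeasure ≪ P0
  density : MemLp (fun x => (toMeasure.rnDeriv P0 x).toReal) p.conjExponent P0

/-- The pairing of a function in `L_p(P0)` with a measure in `𝓜`. -/
def pairing {X : Type*} [MeasurableSpace X] {p : ℝ≥0∞} {P0 : Measure X} (f : Lp ℝ p P0)
    (m : DualProb p P0) : ℝ :=
  ∫ y, f y ∂m.toMeasure

/-- The weak-star topology on `𝓜`. -/
instance {X : Type*} [MeasurableSpace X] (p : ℝ≥0∞) (P0 : Measure X) :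
    TopologicalSpace (DualProb p P0) :=
  TopologicalSpace.induced (fun m (f : Lp ℝ p P0) => pairing f m) inferInstance

/-- The Borel sigma-algebra of the weak-star topology. -/
instance {X : Type*} [MeasurableSpace X] (p : ℝ≥0∞) (P0 : Measure X) :
    MeasurableSpace (DualProb p P0) :=
  borel _

/-- A coherent measure of risk on `L_p(P0)`. -/
structure IsCoherentRisk {X : Type*} [MeasurableSpace X] {p : ℝ≥0∞} {P0 : Measure X}
    [IsProbabilityMeasure P0] [Fact (1 ≤ p)] (ρ : Lp ℝ p P0 → ℝ) : Prop where
  convex : ∀ α : ℝ, 0 < α → α < 1 → ∀ f g : Lp ℝ p P0,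
    ρ (α • f + (1 - α) • g) ≤ α * ρ f + (1 - α) * ρ g
  mono : ∀ f g : Lp ℝ p P0, f ≤ g → ρ f ≤ ρ g
  translation : ∀ (a : ℝ) (f : Lp ℝ p P0), ρ (Lp.const p P0 a + f) = a + ρ f
  pos_homog : ∀ β : ℝ, 0 ≤ β → ∀ f : Lp ℝ p P0, ρ (β • f) = β * ρ f

/-- A law invariant risk transition mapping `σ : L_p(P0) × X × 𝓜 → ℝ`; it is Borel measurable for the
norm topology of `L_p(P0)` and the weak-star topology of `𝓜`. -/
structure IsRiskTransition {X : Type*} [MeasurableSpace X] {p : ℝ≥0∞} {P0 : Measure X}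
    [IsProbabilityMeasure P0] [Fact (1 ≤ p)] (σ : Lp ℝ p P0 → X → DualProb p P0 → ℝ) : Prop where
  measurable : @Measurable (Lp ℝ p P0 × (X × DualProb p P0)) ℝ
    (@Prod.instMeasurableSpace (Lp ℝ p P0) (X × DualProb p P0) (borel (Lp ℝ p P0)) inferInstance)
    inferInstance (fun z => σ z.1 z.2.1 z.2.2)
  coherent : ∀ x m, IsCoherentRisk (fun f => σ f x m)
  law_invariant : ∀ (f g : Lp ℝ p P0) (μ ν : DualProb p P0),
    (∀ η : ℝ, μ.toMeasure {y | f y ≤ η} = ν.toMeasure {y | g y ≤ η}) → ∀ x, σ f x μ = σ g x ν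

/-- The subdifferential of `σ(·, x, m)` at `0` (by monotonicity and translation equivariance all its
elements are probability measures). -/
def riskSubdiff {X : Type*} [MeasurableSpace X] {p : ℝ≥0∞} {P0 : Measure X}
    (σ : Lp ℝ p P0 → X → DualProb p P0 → ℝ) (x : X) (m : DualProb p P0) : Set (DualProb p P0) :=
  {μ | ∀ f : Lp ℝ p P0, σ 0 x m + pairing f μ ≤ σ f x m}

/-- The class in `L_p(P0)` of a function on the state space; the value `0` is only a convention for
functions that are not in `L_p(P0)`. -/
def toV {X : Type*} [MeasurableSpace X] (p : ℝ≥0∞) (P0 : Measure X) (f : X → ℝ) : Lp ℝ p P0 :=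
  open Classical in if h : MemLp f p P0 then h.toLp f else 0

/-! ### Multikernels -/

/-- `M` is a measurable selector of the multikernel `𝔐`. -/
def IsKernelSelector {Y : Type*} [MeasurableSpace Y] (M : Kernel Y Y) (𝔐 : Y → Set (Measure Y)) :
    Prop :=
  ∀ y, M y ∈ 𝔐 y

/-- Composition of multikernels; in Mathlib's notation the kernel that first applies `M₁` and then
`M₂` is `M₂ ∘ₖ M₁`. -/
def multiComp {Y : Type*} [MeasurableSpace Y] (𝔐₁ 𝔐₂ : Y → Set (Measure Y)) :
    Y → Set (Measure Y) :=
  fun y => {m | ∃ M₁ M₂ : Kernel Y Y,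
    IsKernelSelector M₁ 𝔐₁ ∧ IsKernelSelector M₂ 𝔐₂ ∧ m = (M₂ ∘ₖ M₁) y}

/-- `multiPow 𝔐 j` is the power of `𝔐` with exponent `j + 1`. -/
def multiPow {Y : Type*} [MeasurableSpace Y] (𝔐 : Y → Set (Measure Y)) :
    ℕ → Y → Set (Measure Y)
  | 0 => 𝔐
  | j + 1 => multiComp (multiPow 𝔐 j) 𝔐

/-- The Minkowski sum of the powers of `𝔐` with exponents `1, …, T`. -/
def multiPowSum {Y : Type*} [MeasurableSpace Y] (𝔐 : Y → Set (Measure Y)) :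
    ℕ → Y → Set (Measure Y)
  | 0 => fun _ => {0}
  | T + 1 => fun y => {μ | ∃ μ₁ ∈ multiPowSum 𝔐 T y, ∃ μ₂ ∈ multiPow 𝔐 T y, μ = μ₁ + μ₂}

/-- The weighted operator norm of a kernel. -/
def kernelWNorm {Y : Type*} [MeasurableSpace Y] (w : Y → ℝ) (M : Kernel Y Y) : ℝ≥0∞ :=
  ⨆ y, (∫⁻ y', ENNReal.ofReal (w y') ∂M y) / ENNReal.ofReal (w y)

/-- Lower semicontinuity of a multifunction along convergent sequences. -/
def IsLscMultifunction {Z Y : Type*} [TopologicalSpace Z] [TopologicalSpace Y] (F : Z → Set Y) :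
    Prop :=
  ∀ (z : ℕ → Z) (z₀ : Z), Tendsto z atTop (𝓝 z₀) →
    ∀ O : Set Y, IsOpen O → (F z₀ ∩ O).Nonempty → ∀ᶠ k in atTop, (F (z k) ∩ O).Nonempty

namespace ControlledModel

variable {X A : Type*} [MeasurableSpace X] [TopologicalSpace A] [MeasurableSpace A]

/-- The graph of the control multifunction. -/
abbrev Graph (M : ControlledModel X A) : Type _ := {z : X × A // z.2 ∈ M.U z.1}

/-! ### General assumptions -/

/-- The controlled kernel takes values in `𝓜`. -/
def G0 (M : ControlledModel X A) (p : ℝ≥0∞) (P0 : Measure X) : Prop :=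
  ∀ z : M.Graph, M.Q z ≪ P0 ∧
    MemLp (fun x => ((M.Q z).rnDeriv P0 x).toReal) p.conjExponent P0

/-- The transition probability as an element of `𝓜`. -/
def QV (M : ControlledModel X A) {p : ℝ≥0∞} {P0 : Measure X} (h0 : M.G0 p P0) (z : M.Graph) :
    DualProb p P0 where
  toMeasure := M.Q z
  isProb := M.Q_markov.isProbabilityMeasure z
  ac := (h0 z).1
  density := (h0 z).2

/-- Weak-star continuity of the controlled kernel on the graph of `U`. -/
def G1 (M : ControlledModel X A) [TopologicalSpace X] (p : ℝ≥0∞) (P0 : Measure X) : Prop :=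
  ∀ v : Lp ℝ p P0, Continuous (fun z : M.Graph => ∫ y, v y ∂M.Q z)

/-- Lower semicontinuity of the subdifferential multifunction. -/
def G2 [TopologicalSpace X] {p : ℝ≥0∞} {P0 : Measure X}
    (σ : Lp ℝ p P0 → X → DualProb p P0 → ℝ) : Prop :=
  IsLscMultifunction (fun z : X × DualProb p P0 => riskSubdiff σ z.1 z.2)

/-- The cost is measurable, `w`-bounded, and lower semicontinuous in the first two arguments. -/
structure G3 (M : ControlledModel X A) [TopologicalSpace X] (w : X → ℝ) : Prop where
  measurable : Measurable (fun z : X × A × X => M.c z.1 z.2.1 z.2.2)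
  bounded : ∃ C : ℝ, ∀ x, ∀ u ∈ M.U x, ∀ y, |M.c x u y| ≤ C * (w x + w y)
  lsc : ∀ y, LowerSemicontinuous (fun z : X × A => M.c z.1 z.2 y)

/-- The control sets are compact (measurability of `U` is part of the model). -/
def G4 (M : ControlledModel X A) : Prop := ∀ x, IsCompact (M.U x)

/-! ### Policies -/

/-- A deterministic decision rule: a measurable selector of the control multifunction. -/
structure DecisionRule (M : ControlledModel X A) where
  toFun : X → A
  measurable : Measurable toFun
  feasible : ∀ x, toFun x ∈ M.U x

/-- The pair of the state `x` and the control that the decision rule prescribes there. -/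
def DecisionRule.pair {M : ControlledModel X A} (π : M.DecisionRule) (x : X) : M.Graph :=
  ⟨(x, π.toFun x), π.feasible x⟩

/-- Histories with `t` past state-control pairs and a current state. -/
abbrev Hist (M : ControlledModel X A) (t : ℕ) : Type _ := (Fin t → M.Graph) × X

/-- A deterministic, possibly non-stationary and history-dependent policy; `rule t` is used when `t`
transitions have been made. -/
structure Policy (M : ControlledModel X A) where
  rule : ∀ t, M.Hist t → A
  measurable : ∀ t, Measurable (rule t)
  feasible : ∀ t h, rule t h ∈ M.U h.2

/-- The policy is Markov: each control depends on the history only through the current state. -/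
def Policy.IsMarkov {M : ControlledModel X A} (Λ : M.Policy) : Prop :=
  ∃ π : ℕ → M.DecisionRule, ∀ t (h : M.Hist t), Λ.rule t h = (π t).toFun h.2

/-- The stationary deterministic Markov policy `{π, π, …}`. -/
def stationary {M : ControlledModel X A} (π : M.DecisionRule) : M.Policy where
  rule _ h := π.toFun h.2
  measurable _ := π.measurable.comp measurable_snd
  feasible _ h := π.feasible h.2

/-- The current state and the control applied there by the policy. -/
def Policy.pair {M : ControlledModel X A} (Λ : M.Policy) (t : ℕ) (h : M.Hist t) : M.Graph :=
  ⟨(h.2, Λ.rule t h), Λ.feasible t h⟩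

/-- The history after a transition to the state `y` under the policy. -/
def Policy.next {M : ControlledModel X A} (Λ : M.Policy) (t : ℕ) (h : M.Hist t) (y : X) :
    M.Hist (t + 1) :=
  (Fin.snoc (α := fun _ => M.Graph) h.1 (Λ.pair t h), y)

/-- The cost of the last transition of a history. -/
def lastCost (M : ControlledModel X A) (t : ℕ) (h : M.Hist (t + 1)) : ℝ :=
  M.c (h.1 (Fin.last t)).1.1 (h.1 (Fin.last t)).1.2 h.2

/-! ### Dynamic risk -/

section risk

variable (M : ControlledModel X A) {p : ℝ≥0∞} {P0 : Measure X}
  (σ : Lp ℝ p P0 → X → DualProb p P0 → ℝ) (h0 : M.G0 p P0)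

/-- The value `σ(f, x, Q(x, u))` for `z = (x, u)`. -/
def riskAt (f : X → ℝ) (z : M.Graph) : ℝ := σ (toV p P0 f) z.1.1 (M.QV h0 z)

/-- The one-step conditional (Markov) risk measure: it maps functions of the history after the next
transition to functions of the current history. -/
def condRisk (Λ : M.Policy) (t : ℕ) (Z : M.Hist (t + 1) → ℝ) (h : M.Hist t) : ℝ :=
  M.riskAt σ h0 (fun y => Z (Λ.next t h y)) (Λ.pair t h)

/-- The nested risk of the costs of the next `n` transitions, as a function of the history. -/
def tailRisk (Λ : M.Policy) : ℕ → ∀ t : ℕ, M.Hist t → ℝ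
  | 0, _ => fun _ => 0
  | n + 1, t => M.condRisk σ h0 Λ t (fun h => M.lastCost t h + tailRisk Λ n (t + 1) h)

/-- The finite horizon risk `J_T(Λ, x)`. -/
def J (Λ : M.Policy) (T : ℕ) (x : X) : ℝ := M.tailRisk σ h0 Λ T 0 (Fin.elim0, x)

/-- The infinite horizon risk `J_∞(Λ, x) = liminf J_T(Λ, x)`, an extended real number. -/
def Jinf (Λ : M.Policy) (x : X) : EReal := liminf (fun T => (M.J σ h0 Λ T x : EReal)) atTop

/-- The optimal value over a class of policies. -/
def Jopt (S : Set M.Policy) (x : X) : EReal := ⨅ Λ ∈ S, M.Jinf σ h0 Λ x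

/-- The expression `σ(c(x, u, ·) + v(·), x, Q(x, u))` for `z = (x, u)`. -/
def bellman (v : X → ℝ) (z : M.Graph) : ℝ :=
  M.riskAt σ h0 (fun y => M.c z.1.1 z.1.2 y + v y) z

/-- The dynamic programming equations `v(x) = inf_{u ∈ U(x)} σ(c(x, u, ·) + v(·), x, Q(x, u))` for all
states `x`, and `v = 0` at the absorbing state. -/
def SolvesDP (v : X → ℝ) : Prop :=
  (∀ x, IsGLB (Set.range fun u : M.U x => M.bellman σ h0 v ⟨(x, u.1), u.2⟩) (v x)) ∧ v M.xA = 0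

/-- The decision rule attains the minimum over `U(x)` in the dynamic programming equation for every
state `x`. -/
def IsMinimizer (v : X → ℝ) (π : M.DecisionRule) : Prop :=
  ∀ x, ∀ u : M.U x, M.bellman σ h0 v (π.pair x) ≤ M.bellman σ h0 v ⟨(x, u.1), u.2⟩

/-- The risk multikernel of a decision rule. -/
def riskMultikernel (π : M.DecisionRule) (x : X) : Set (Measure X) :=
  DualProb.toMeasure '' riskSubdiff σ x (M.QV h0 (π.pair x))

/-- The effective state space. -/
abbrev Eff : Type _ := {x : X // x ≠ M.xA}

/-- The effective risk multikernel: the measures are restricted to the effective state space. -/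
def effMultikernel (π : M.DecisionRule) (x : M.Eff) : Set (Measure M.Eff) :=
  (fun μ => Measure.comap Subtype.val μ) '' M.riskMultikernel σ h0 π x.1

/-- The model is uniformly risk-transient with the weight function `w`: one constant `K` bounds the
weighted norms of all selectors of all sums of powers, for all stationary policies. -/
def UniformlyRiskTransient (w : X → ℝ) : Prop :=
  ∃ K : ℝ≥0, ∀ (π : M.DecisionRule) (T : ℕ) (N : Kernel M.Eff M.Eff),
    IsKernelSelector N (multiPowSum (M.effMultikernel σ h0 π) T) →
      kernelWNorm (fun x : M.Eff => w x.1) N ≤ K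

end risk

end ControlledModel

/-- A function is bounded with respect to the weight `w`. -/
def WBounded {X : Type*} (w v : X → ℝ) : Prop := ∃ C : ℝ, ∀ x, |v x| ≤ C * w x

end

/-!
The proof rests on one weight function that is contracted by the one-step risk under all controls at
once, although risk transience is assumed for stationary policies only.

*Kernels of subgradients.*  A coherent risk measure on `L_p` is bounded, and exposing its
subdifferential successively by the members of a dense sequence of directions leaves a single
measure (`IsCoherentRisk.exists_dualProb_faceLim`).  The support functions of the exposed faces are
directional derivatives, hence measurable in a parameter, so that the measure found is a kernel
selector at which the risk of the first direction is attained
(`exists_kernel_riskMultikernel`).  For a decision rule, the nested risk of the weights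
accumulated over `T` steps is therefore the integral of the weight with respect to a selector of the
sum of the powers of the multikernel, and transience bounds it by a multiple of the weight
(`weightIter_bound`).  In the limit one obtains a solution of the evaluation equation
`W = w + σ(W)` for each decision rule.  All functions here vanish at the absorbing state, where law
invariance makes the risk the value of the certain next state.

*Policy improvement.*  Starting from any decision rule, improve it in turn by the rules of a dense
family, each used infinitely often.  The accumulated weights increase and stay below a multiple of
the weight; their limit cannot be improved by any rule of the family and, by lower semicontinuity of
the risk in the control (`eventually_lt_riskAt`), by no control at all.  The limit `W` satisfies
`w + σ(W) ≤ W ≤ (1 + K) w` for all controls, hence `σ(W) ≤ θ W` with `θ = K / (1 + K)`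
(`exists_isContractiveWeight`).

*Dynamic programming.*  Measured by `W`, the Bellman operator is a contraction and value iteration
converges (`exists_solvesDP`); minimizing controls can be selected measurably because Bellman values
are lower semicontinuous where the weight is bounded (`exists_isMinimizer`).  Iterating the equation
along an arbitrary policy leaves an error of at most a multiple of `θ ^ T W`, which proves that a
solution is a lower bound for all policies and is attained by the minimizing rules
(`le_tailRisk_add`, `tailRisk_stationary_le`).
-/

noncomputable section

/-! ### Measurable selections of compact-valued multifunctions -/

theorem IsCompact.nonempty_iInter_of_antitone_nat {A : Type*} [TopologicalSpace A] [T2Space A]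
    {s : ℕ → Set A} (hs : Antitone s) (hc : ∀ i, IsCompact (s i)) (hn : ∀ i, (s i).Nonempty) :
    (⋂ i, s i).Nonempty :=
  IsCompact.nonempty_iInter_of_sequence_nonempty_isCompact_isClosed s
    (fun i => hs i.le_succ) hn (hc 0) (fun i => (hc i).isClosed)

/-- A multifunction with nonempty compact values for which the inverse images of closed sets are
measurable. -/
structure IsMeasurableCompactMultifunction {X A : Type*} [MeasurableSpace X] [TopologicalSpace A]
    (Γ : X → Set A) : Prop where
  nonempty : ∀ x, (Γ x).Nonempty
  compact : ∀ x, IsCompact (Γ x)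
  measurable : ∀ F : Set A, IsClosed F → MeasurableSet {x | (Γ x ∩ F).Nonempty}

/-- The points of `Γ x` at which `φ x` attains its minimum over `Γ x`. -/
def argminOn {X A : Type*} (Γ : X → Set A) (φ : X → A → ℝ) (x : X) : Set A :=
  {a ∈ Γ x | ∀ b ∈ Γ x, φ x a ≤ φ x b}

/-- Measurability of minimisers of a function that is lower semicontinuous in the second argument
and whose sublevel sets have measurable projections. -/
theorem IsMeasurableCompactMultifunction.argminOn_of_lsc {X A : Type*} [MeasurableSpace X]
    [TopologicalSpace A] [T2Space A] {Γ : X → Set A} (hΓ : IsMeasurableCompactMultifunction Γ)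
    {φ : X → A → ℝ} (hφ : ∀ x, LowerSemicontinuousOn (φ x) (Γ x))
    (hm : ∀ F : Set A, IsClosed F → ∀ q : ℝ,
      MeasurableSet {x | (Γ x ∩ (F ∩ {a | φ x a ≤ q})).Nonempty}) :
    IsMeasurableCompactMultifunction (argminOn Γ φ) where
  nonempty x := by
    obtain ⟨a, ha, hmin⟩ := (hφ x).exists_isMinOn (hΓ.nonempty x) (hΓ.compact x)
    exact ⟨a, ha, fun b hb => hmin hb⟩
  compact x := by
    refine (hΓ.compact x).of_isClosed_subset (isClosed_of_closure_subset fun a ha => ?_)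
      (Set.sep_subset _ _)
    have haΓ : a ∈ Γ x :=
      (hΓ.compact x).isClosed.closure_subset_iff.2 (Set.sep_subset _ _) ha
    refine ⟨haΓ, fun b hb => ?_⟩
    by_contra! hlt
    have h1 := hφ x a haΓ _ hlt
    rw [eventually_nhdsWithin_iff] at h1
    obtain ⟨a', hlt', ha'⟩ := (mem_closure_iff_frequently.1 ha).and_eventually h1 |>.exists
    exact (ha' hlt'.1).not_ge (hlt'.2 b hb)
  measurable F hF := by
    -- The minimum over `Γ x ∩ F` is at most the minimum over `Γ x`, tested by rational numbers.
    have : {x | (argminOn Γ φ x ∩ F).Nonempty} =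
        {x | (Γ x ∩ F).Nonempty} ∩
          ⋂ q : ℚ, ({x | (Γ x ∩ (Set.univ ∩ {a | φ x a ≤ (q : ℝ)})).Nonempty}ᶜ ∪
            {x | (Γ x ∩ (F ∩ {a | φ x a ≤ (q : ℝ)})).Nonempty}) := by
      ext x
      simp only [Set.mem_ofPred_eq, Set.mem_inter_iff, Set.mem_iInter, Set.mem_union,
        Set.mem_compl_iff]
      constructor
      · rintro ⟨a, ⟨ha, hmin⟩, haF⟩
        refine ⟨⟨a, ha, haF⟩, fun q => ?_⟩
        by_cases h : (Γ x ∩ (Set.univ ∩ {a | φ x a ≤ (q : ℝ)})).Nonempty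
        · obtain ⟨b, hb, -, hbq⟩ := h
          exact Or.inr ⟨a, ha, haF, (hmin b hb).trans hbq⟩
        · exact Or.inl h
      · rintro ⟨hne, hq⟩
        obtain ⟨a, ⟨ha, haF⟩, hmin⟩ := ((hφ x).mono Set.inter_subset_left).exists_isMinOn hne
          ((hΓ.compact x).inter_right hF)
        refine ⟨a, ⟨ha, fun b hb => ?_⟩, haF⟩
        by_contra! hlt
        obtain ⟨q, hq1, hq2⟩ := exists_rat_btwn hlt
        rcases hq q with h | ⟨a', ha', haF', hle⟩
        · exact h ⟨b, hb, trivial, hq1.le⟩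
        · have : φ x a ≤ φ x a' := hmin ⟨ha', haF'⟩
          exact absurd (this.trans hle) (not_le.2 hq2)
    rw [this]
    exact (hΓ.measurable F hF).inter (MeasurableSet.iInter fun q =>
      (hm _ isClosed_univ q).compl.union (hm F hF q))

theorem IsMeasurableCompactMultifunction.argminOn {X A : Type*} [MeasurableSpace X]
    [TopologicalSpace A] [T2Space A] {Γ : X → Set A} (hΓ : IsMeasurableCompactMultifunction Γ)
    {φ : A → ℝ} (hφ : Continuous φ) :
    IsMeasurableCompactMultifunction (argminOn Γ fun _ => φ) :=
  hΓ.argminOn_of_lsc (fun _ => hφ.lowerSemicontinuous.lowerSemicontinuousOn _) fun _ hF _ =>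
    hΓ.measurable _ (hF.inter (isClosed_le hφ continuous_const))

/-- A measurable selection theorem for compact values: minimise the distances to the points of a
dense sequence one after the other; the surviving point depends measurably on the parameter. -/
theorem IsMeasurableCompactMultifunction.exists_selector {X A : Type*} [MeasurableSpace X]
    [TopologicalSpace A] [TopologicalSpace.MetrizableSpace A] [SecondCountableTopology A]
    [MeasurableSpace A] [BorelSpace A] {Γ : X → Set A}
    (hΓ : IsMeasurableCompactMultifunction Γ) :
    ∃ f : X → A, Measurable f ∧ ∀ x, f x ∈ Γ x := by
  let := TopologicalSpace.metrizableSpaceMetric A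
  rcases isEmpty_or_nonempty X with hX | ⟨⟨x₀⟩⟩
  · exact ⟨fun x => (hX.false x).elim, measurable_of_empty _, fun x => (hX.false x).elim⟩
  have : Nonempty A := ⟨(hΓ.nonempty x₀).some⟩
  let d : ℕ → A := TopologicalSpace.denseSeq A
  let G : ℕ → X → Set A := fun n =>
    Nat.rec Γ (fun i H => _root_.argminOn H (fun _ a => dist a (d i))) n
  have hG : ∀ n, IsMeasurableCompactMultifunction (G n) := by
    intro n
    induction n with
    | zero => exact hΓ
    | succ n ih => exact ih.argminOn (continuous_id.dist continuous_const)
  have hanti : ∀ x, Antitone fun n => G n x := fun x =>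
    antitone_nat_of_succ_le fun n a ha => ha.1
  have hne : ∀ x, (⋂ n, G n x).Nonempty := fun x =>
    IsCompact.nonempty_iInter_of_antitone_nat (hanti x) (fun i => (hG i).compact x)
      fun i => (hG i).nonempty x
  have huniq : ∀ x, ∀ a ∈ ⋂ n, G n x, ∀ b ∈ ⋂ n, G n x, a = b := by
    intro x a ha b hb
    rw [Set.mem_iInter] at ha hb
    have hd : ∀ i, dist a (d i) = dist b (d i) := fun i =>
      le_antisymm ((ha (i + 1)).2 b (hb i)) ((hb (i + 1)).2 a (ha i))
    refine dist_le_zero.1 (le_of_forall_pos_le_add fun ε hε => ?_)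
    obtain ⟨i, hi⟩ := (TopologicalSpace.denseRange_denseSeq A).exists_dist_lt a (half_pos hε)
    have h1 := dist_triangle_right a b (d i)
    rw [← hd i] at h1
    have : dist a (d i) < ε / 2 := hi
    linarith
  refine ⟨fun x => (hne x).some, measurable_of_isClosed fun F hF => ?_, fun x => ?_⟩
  · have : (fun x => (hne x).some) ⁻¹' F = ⋂ n, {x | (G n x ∩ F).Nonempty} := by
      ext x
      simp only [Set.mem_preimage, Set.mem_iInter, Set.mem_ofPred_eq]
      constructor
      · exact fun h n => ⟨_, Set.mem_iInter.1 (hne x).some_mem n, h⟩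
      · intro h
        obtain ⟨a, ha⟩ := IsCompact.nonempty_iInter_of_antitone_nat (s := fun n => G n x ∩ F)
          (fun i j hij => Set.inter_subset_inter_left _ (hanti x hij))
          (fun i => ((hG i).compact x).inter_right hF) h
        rw [Set.mem_iInter] at ha
        rw [huniq x _ (hne x).some_mem a (Set.mem_iInter.2 fun n => (ha n).1)]
        exact (ha 0).2
    rw [this]
    exact MeasurableSet.iInter fun n => (hG n).measurable F hF
  · exact Set.mem_iInter.1 (hne x).some_mem 0

/-- The projection of the part of a closed set that lies in the graph of a compact-valued
multifunction is measurable. -/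
theorem measurableSet_exists_mem_of_isClosed {X A : Type*}
    [TopologicalSpace X] [TopologicalSpace.MetrizableSpace X] [SecondCountableTopology X]
    [MeasurableSpace X] [BorelSpace X]
    [TopologicalSpace A] [TopologicalSpace.MetrizableSpace A] [SecondCountableTopology A]
    {U : X → Set A} (hcpt : ∀ x, IsCompact (U x))
    (hmeas : ∀ O : Set A, IsOpen O → MeasurableSet {x | (U x ∩ O).Nonempty})
    {C : Set (X × A)} (hC : IsClosed C) : MeasurableSet {x | ∃ u ∈ U x, (x, u) ∈ C} := by
  let := TopologicalSpace.metrizableSpaceMetric X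
  let := TopologicalSpace.metrizableSpaceMetric A
  have hopen : ∀ O : Set (X × A), IsOpen O → MeasurableSet {x | ∃ u ∈ U x, (x, u) ∈ O} := by
    intro O hO
    let B := TopologicalSpace.countableBasis X
    let D := TopologicalSpace.countableBasis A
    have hB := TopologicalSpace.isBasis_countableBasis X
    have hD := TopologicalSpace.isBasis_countableBasis A
    have : {x | ∃ u ∈ U x, (x, u) ∈ O} =
        ⋃ b ∈ B, ⋃ e ∈ {e ∈ D | b ×ˢ e ⊆ O}, b ∩ {x | (U x ∩ e).Nonempty} := by
      ext x
      simp only [Set.mem_ofPred_eq, Set.mem_iUnion, Set.mem_inter_iff, exists_prop]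
      constructor
      · rintro ⟨u, hu, hxu⟩
        obtain ⟨s, ⟨b, hb, e, he, rfl⟩, hmem, hsub⟩ :=
          (hB.prod hD).exists_subset_of_mem_open hxu hO
        exact ⟨b, hb, e, ⟨he, hsub⟩, hmem.1, u, hu, hmem.2⟩
      · rintro ⟨b, _, e, ⟨_, hsub⟩, hxb, u, hu, hue⟩
        exact ⟨u, hu, hsub ⟨hxb, hue⟩⟩
    rw [this]
    refine MeasurableSet.biUnion (TopologicalSpace.countable_countableBasis X) fun b hb =>
      MeasurableSet.biUnion ((TopologicalSpace.countable_countableBasis A).mono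
        (Set.sep_subset _ _)) fun e he => ?_
    exact (hB.isOpen hb).measurableSet.inter (hmeas e (hD.isOpen he.1))
  rcases C.eq_empty_or_nonempty with rfl | hne
  · simp
  have : {x | ∃ u ∈ U x, (x, u) ∈ C} = ⋂ n : ℕ, {x | ∃ u ∈ U x,
      (x, u) ∈ {z | Metric.infDist z C < 1 / ((n : ℝ) + 1)}} := by
    ext x
    simp only [Set.mem_ofPred_eq, Set.mem_iInter]
    constructor
    · rintro ⟨u, hu, hxu⟩ n
      refine ⟨u, hu, ?_⟩
      rw [Metric.infDist_zero_of_mem hxu]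
      positivity
    · intro h
      obtain ⟨u, hu⟩ : (U x).Nonempty := let ⟨u, hu, _⟩ := h 0; ⟨u, hu⟩
      obtain ⟨a, ha, hmin⟩ := (hcpt x).exists_isMinOn ⟨u, hu⟩
        (f := fun u => Metric.infDist ((x, u) : X × A) C) (by fun_prop)
      refine ⟨a, ha, (hC.mem_iff_infDist_zero hne).2 (le_antisymm ?_ Metric.infDist_nonneg)⟩
      refine ge_of_tendsto' tendsto_one_div_add_atTop_nhds_zero_nat fun n => ?_
      obtain ⟨b, hb, hlt⟩ := h n
      exact (show _ ≤ Metric.infDist ((x, b) : X × A) C from hmin hb).trans hlt.le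
  rw [this]
  exact MeasurableSet.iInter fun n => hopen _
    (isOpen_lt (Metric.continuous_infDist_pt _) continuous_const)

theorem isMeasurableCompactMultifunction_of_isOpen {X A : Type*}
    [TopologicalSpace X] [TopologicalSpace.MetrizableSpace X] [SecondCountableTopology X]
    [MeasurableSpace X] [BorelSpace X]
    [TopologicalSpace A] [TopologicalSpace.MetrizableSpace A] [SecondCountableTopology A]
    {U : X → Set A} (hne : ∀ x, (U x).Nonempty) (hcpt : ∀ x, IsCompact (U x))
    (hmeas : ∀ O : Set A, IsOpen O → MeasurableSet {x | (U x ∩ O).Nonempty}) :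
    IsMeasurableCompactMultifunction U where
  nonempty := hne
  compact := hcpt
  measurable F hF := by
    simpa [Set.Nonempty] using measurableSet_exists_mem_of_isClosed hcpt hmeas
      (hF.preimage (continuous_snd : Continuous (Prod.snd : X × A → A)))

namespace ControlledModel

variable {X A : Type*} [TopologicalSpace X] [TopologicalSpace.MetrizableSpace X]
  [SecondCountableTopology X] [MeasurableSpace X] [BorelSpace X]
  [TopologicalSpace A] [TopologicalSpace.MetrizableSpace A] [SecondCountableTopology A]
  [MeasurableSpace A] [BorelSpace A] (M : ControlledModel X A)

/-- A Castaing representation of the control multifunction: countably many decision rules whose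
values are dense in every control set.  The rule with index `n` picks a control nearest to the
point with index `n` of a dense sequence. -/
theorem exists_dense_decisionRules (h4 : M.G4) :
    ∃ π : ℕ → M.DecisionRule, ∀ x, ∀ u ∈ M.U x, u ∈ closure (Set.range fun n => (π n).toFun x) := by
  let := TopologicalSpace.metrizableSpaceMetric A
  have : Nonempty A := ⟨(M.U_nonempty M.xA).some⟩
  have hU := isMeasurableCompactMultifunction_of_isOpen M.U_nonempty h4 M.U_measurable
  let d : ℕ → A := TopologicalSpace.denseSeq A
  have hsel : ∀ n, ∃ f : X → A, Measurable f ∧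
      ∀ x, f x ∈ argminOn M.U (fun _ a => dist a (d n)) x := fun n =>
    (hU.argminOn (continuous_id.dist continuous_const)).exists_selector
  choose f hf hfU using hsel
  refine ⟨fun n => ⟨f n, hf n, fun x => (hfU n x).1⟩, fun x u hu => ?_⟩
  refine Metric.mem_closure_range_iff.2 fun ε hε => ?_
  obtain ⟨n, hn⟩ := (TopologicalSpace.denseRange_denseSeq A).exists_dist_lt u (half_pos hε)
  refine ⟨n, ?_⟩
  have h1 : dist (f n x) (d n) ≤ dist u (d n) := (hfU n x).2 u hu
  have h2 : dist u (d n) < ε / 2 := hn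
  have h3 := dist_triangle_right u (f n x) (d n)
  change dist u (f n x) < ε
  linarith

end ControlledModel

/-! ### Exposing a linear minorant of a sublinear functional -/

/-- Subadditive functionals that commute with multiplication by natural numbers. -/
structure IsNatSublinear {E : Type*} [AddCommGroup E] (s : E → ℝ) : Prop where
  add_le : ∀ f g, s (f + g) ≤ s f + s g
  nsmul : ∀ (n : ℕ) (f : E), s (n • f) = n * s f

/-- The directional derivative at `f`, in the direction `g`, of a sublinear functional `s`.  If `s`
is the support function of a convex set, then `faceFunctional s f` is the support function of its
face exposed by `f`. -/
def faceFunctional {E : Type*} [AddCommGroup E] (s : E → ℝ) (f g : E) : ℝ :=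
  ⨅ n : ℕ, (s (n • f + g) - n * s f)

/-- The support function of the face that remains after exposing by `d 0, …, d (n - 1)`. -/
def faceSeq {E : Type*} [AddCommGroup E] (s : E → ℝ) (d : ℕ → E) : ℕ → E → ℝ
  | 0 => s
  | n + 1 => faceFunctional (faceSeq s d n) (d n)

/-- The support function of the intersection of the successively exposed faces. -/
def faceLim {E : Type*} [AddCommGroup E] (s : E → ℝ) (d : ℕ → E) (g : E) : ℝ :=
  ⨅ n, faceSeq s d n g

namespace IsNatSublinear

section group

variable {E : Type*} [AddCommGroup E] {s : E → ℝ} (hs : IsNatSublinear s)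
include hs

theorem map_zero : s 0 = 0 := by simpa using hs.nsmul 0 0

theorem neg_le (g : E) : -s (-g) ≤ s g := by
  have := hs.add_le g (-g)
  rw [add_neg_cancel, hs.map_zero] at this
  linarith

theorem face_bddBelow (f g : E) :
    BddBelow (Set.range fun n : ℕ => s (n • f + g) - n * s f) := by
  refine ⟨-s (-g), ?_⟩
  rintro _ ⟨n, rfl⟩
  have h := hs.add_le (n • f + g) (-g)
  rw [add_neg_cancel_right, hs.nsmul] at h
  change _ ≤ s (n • f + g) - n * s f
  linarith

theorem face_antitone (f g : E) : Antitone fun n : ℕ => s (n • f + g) - n * s f := by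
  refine antitone_nat_of_succ_le fun n => ?_
  have h := hs.add_le (n • f + g) f
  have e : (n + 1) • f + g = n • f + g + f := by rw [succ_nsmul]; abel
  rw [e]
  push_cast
  linarith

theorem face_le (f g : E) (n : ℕ) : faceFunctional s f g ≤ s (n • f + g) - n * s f :=
  ciInf_le (hs.face_bddBelow f g) n

theorem face_le_self (f g : E) : faceFunctional s f g ≤ s g := by
  simpa using hs.face_le f g 0

theorem face_tendsto (f g : E) :
    Tendsto (fun n : ℕ => s (n • f + g) - n * s f) atTop (𝓝 (faceFunctional s f g)) :=
  tendsto_atTop_ciInf (hs.face_antitone f g) (hs.face_bddBelow f g)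

theorem face (f : E) : IsNatSublinear (faceFunctional s f) where
  add_le g h := by
    have hlim := (hs.face_tendsto f g).add (hs.face_tendsto f h)
    refine ge_of_tendsto' hlim fun n => ?_
    refine (hs.face_le f (g + h) (n + n)).trans ?_
    have h1 := hs.add_le (n • f + g) (n • f + h)
    have e : (n + n) • f + (g + h) = n • f + g + (n • f + h) := by rw [add_nsmul]; abel
    rw [e]
    push_cast
    linarith
  nsmul k g := by
    rcases k.eq_zero_or_pos with rfl | hk
    · have : ∀ n : ℕ, s (n • f + 0 • g) - n * s f = 0 := fun n => by
        rw [zero_nsmul, add_zero, hs.nsmul, sub_self]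
      simp only [faceFunctional, this, ciInf_const]
      simp
    · have h1 := (hs.face_tendsto f (k • g)).comp (tendsto_id.const_mul_atTop' hk)
      have h2 := (hs.face_tendsto f g).const_mul (k : ℝ)
      refine tendsto_nhds_unique h1 (h2.congr fun n => ?_)
      have e : (k * n) • f + k • g = k • (n • f + g) := by rw [nsmul_add, mul_nsmul']
      simp only [Function.comp_apply, id, e, hs.nsmul]
      push_cast
      ring

theorem face_neg_le (f : E) : faceFunctional s f (-f) ≤ -s f := by
  have := hs.face_le f (-f) 1
  rw [one_nsmul, add_neg_cancel, hs.map_zero] at this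
  simpa using this

theorem faceSeq (d : ℕ → E) (n : ℕ) : IsNatSublinear (faceSeq s d n) := by
  induction n with
  | zero => exact hs
  | succ n ih => exact ih.face (d n)

theorem faceSeq_antitone (d : ℕ → E) (g : E) : Antitone fun n => _root_.faceSeq s d n g :=
  antitone_nat_of_succ_le fun n => (hs.faceSeq d n).face_le_self (d n) g

theorem faceSeq_bddBelow (d : ℕ → E) (g : E) :
    BddBelow (Set.range fun n => _root_.faceSeq s d n g) := by
  refine ⟨-s (-g), ?_⟩
  rintro _ ⟨n, rfl⟩
  have h1 : _root_.faceSeq s d n (-g) ≤ s (-g) := hs.faceSeq_antitone d (-g) (Nat.zero_le n)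
  have h2 := (hs.faceSeq d n).neg_le g
  change _ ≤ _root_.faceSeq s d n g
  linarith

theorem faceLim_le (d : ℕ → E) (g : E) (n : ℕ) : faceLim s d g ≤ _root_.faceSeq s d n g :=
  ciInf_le (hs.faceSeq_bddBelow d g) n

theorem faceLim_tendsto (d : ℕ → E) (g : E) :
    Tendsto (fun n => _root_.faceSeq s d n g) atTop (𝓝 (faceLim s d g)) :=
  tendsto_atTop_ciInf (hs.faceSeq_antitone d g) (hs.faceSeq_bddBelow d g)

theorem faceLim (d : ℕ → E) : IsNatSublinear (faceLim s d) where
  add_le g h := le_of_tendsto_of_tendsto' (hs.faceLim_tendsto d (g + h))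
    ((hs.faceLim_tendsto d g).add (hs.faceLim_tendsto d h)) fun n => (hs.faceSeq d n).add_le g h
  nsmul k g := tendsto_nhds_unique (hs.faceLim_tendsto d (k • g))
    (((hs.faceLim_tendsto d g).const_mul (k : ℝ)).congr fun n => ((hs.faceSeq d n).nsmul k g).symm)

/-- The limit is linear along each exposing direction. -/
theorem faceLim_neg_le (d : ℕ → E) (n : ℕ) :
    _root_.faceLim s d (-d n) ≤ -_root_.faceSeq s d n (d n) :=
  (hs.faceLim_le d (-d n) (n + 1)).trans ((hs.faceSeq d n).face_neg_le (d n))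

theorem faceLim_apply (d : ℕ → E) (n : ℕ) :
    _root_.faceLim s d (d n) = _root_.faceSeq s d n (d n) := by
  refine le_antisymm (hs.faceLim_le d _ n) ?_
  have h1 := hs.faceLim_neg_le d n
  have h2 := (hs.faceLim d).neg_le (d n)
  linarith

end group

/-- Exposing a bounded sublinear functional by a dense sequence of directions leaves a bounded
linear functional. -/
theorem exists_eq_faceLim {E : Type*} [NormedAddCommGroup E] [NormedSpace ℝ E] {s : E → ℝ}
    (hs : IsNatSublinear s) {L : ℝ} (hL : ∀ f, s f ≤ L * ‖f‖) {d : ℕ → E} (hd : DenseRange d) :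
    ∃ l : E →L[ℝ] ℝ, ∀ g, l g = _root_.faceLim s d g := by
  set t := _root_.faceLim s d with ht
  have hsub : IsNatSublinear t := hs.faceLim d
  have hbd : ∀ g, t g ≤ L * ‖g‖ := fun g => (hs.faceLim_le d g 0).trans (hL g)
  have habs : ∀ f g, |t f - t g| ≤ L * ‖f - g‖ := by
    intro f g
    rw [abs_sub_le_iff]
    constructor
    · have := hsub.add_le (f - g) g
      rw [sub_add_cancel] at this
      linarith [hbd (f - g)]
    · have := hsub.add_le (g - f) f
      rw [sub_add_cancel] at this
      have h2 := hbd (g - f)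
      rw [norm_sub_rev] at h2
      linarith
  have hcont : Continuous t := by
    refine (LipschitzWith.of_dist_le' (K := L) fun f g => ?_).continuous
    rw [Real.dist_eq, dist_eq_norm]
    exact habs f g
  have hneg : ∀ f, t (-f) = -t f := by
    refine fun f => hd.induction_on (p := fun f => t (-f) = -t f) f ?_ fun n => ?_
    · exact isClosed_eq (hcont.comp continuous_neg) hcont.neg
    · have h1 := hs.faceLim_neg_le d n
      rw [← hs.faceLim_apply d n] at h1
      have h2 := hsub.neg_le (d n)
      exact le_antisymm h1 (by linarith)
  have hadd : ∀ f g, t (f + g) = t f + t g := by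
    intro f g
    refine le_antisymm (hsub.add_le f g) ?_
    have := hsub.add_le (-f) (-g)
    rw [← neg_add, hneg, hneg, hneg] at this
    linarith
  exact ⟨(AddMonoidHom.mk' t hadd).toRealLinearMap hcont, fun g => rfl⟩

end IsNatSublinear

/-! ### Coherent risk measures -/

namespace IsCoherentRisk

variable {X : Type*} [MeasurableSpace X] {p : ℝ≥0∞} {P0 : Measure X} [IsProbabilityMeasure P0]
  [Fact (1 ≤ p)] {ρ : Lp ℝ p P0 → ℝ} (hρ : IsCoherentRisk ρ)
include hρ

theorem add_le (f g : Lp ℝ p P0) : ρ (f + g) ≤ ρ f + ρ g := by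
  have h := hρ.convex (1 / 2) (by norm_num) (by norm_num) ((2 : ℝ) • f) ((2 : ℝ) • g)
  rw [hρ.pos_homog 2 (by norm_num), hρ.pos_homog 2 (by norm_num), smul_smul, smul_smul] at h
  norm_num at h
  linarith

theorem isNatSublinear : IsNatSublinear ρ where
  add_le := hρ.add_le
  nsmul n f := by
    rw [← Nat.cast_smul_eq_nsmul ℝ]
    exact hρ.pos_homog n n.cast_nonneg f

theorem map_zero : ρ 0 = 0 := hρ.isNatSublinear.map_zero

theorem map_const (a : ℝ) : ρ (Lp.const p P0 a) = a := by
  have := hρ.translation a 0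
  rwa [add_zero, hρ.map_zero, add_zero] at this

/-- A finite coherent risk measure on `L_p` is bounded: otherwise it would be infinite at a sum of
nonnegative functions with summable norms and unbounded risks. -/
theorem exists_bound : ∃ L : ℝ, 0 ≤ L ∧ ∀ f, ρ f ≤ L * ‖f‖ := by
  by_contra! H
  have hex : ∀ n : ℕ, ∃ g : Lp ℝ p P0, 0 ≤ g ∧ ‖g‖ = (1 / 2) ^ n ∧ n ≤ ρ g := by
    intro n
    obtain ⟨f, hf⟩ := H (n * 2 ^ n) (by positivity)
    have hf0 : f ≠ 0 := by
      rintro rfl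
      simp [hρ.map_zero] at hf
    have hpos : 0 < ‖f‖ := norm_pos_iff.2 hf0
    refine ⟨((1 / 2) ^ n * ‖f‖⁻¹) • |f|, ?_, ?_, ?_⟩
    · rw [← Lp.coeFn_nonneg]
      filter_upwards [Lp.coeFn_smul ((1 / 2 : ℝ) ^ n * ‖f‖⁻¹) |f|, Lp.coeFn_abs f] with x h1 h2
      rw [h1, Pi.smul_apply, h2, smul_eq_mul]
      have : 0 ≤ |f x| := abs_nonneg _
      simp only [Pi.zero_apply]
      positivity
    · rw [norm_smul, norm_abs_eq_norm, norm_mul, norm_inv, norm_norm, mul_assoc,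
        inv_mul_cancel₀ hpos.ne', mul_one]
      simp
    · rw [hρ.pos_homog _ (by positivity)]
      have h1 : ρ f ≤ ρ |f| := hρ.mono _ _ (le_abs_self f)
      have h2 : n * 2 ^ n * ‖f‖ < ρ |f| := hf.trans_le h1
      calc (n : ℝ) = (1 / 2) ^ n * ‖f‖⁻¹ * (n * 2 ^ n * ‖f‖) := by
            have e : (1 / 2 : ℝ) ^ n * 2 ^ n = 1 := by rw [← mul_pow]; norm_num
            field_simp
            rw [mul_assoc, e, mul_one]
        _ ≤ _ := mul_le_mul_of_nonneg_left h2.le (by positivity)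
  choose g hg0 hgn hgρ using hex
  have hsum : Summable g := by
    refine Summable.of_norm ?_
    simp only [hgn]
    exact summable_geometric_of_lt_one (by norm_num) (by norm_num)
  obtain ⟨n, hn⟩ := exists_nat_gt (ρ (∑' n, g n))
  have h1 : g n ≤ ∑' n, g n := hsum.le_tsum n fun i _ => hg0 i
  linarith [hgρ n, hρ.mono _ _ h1]

theorem continuous : Continuous ρ := by
  obtain ⟨L, -, hL⟩ := hρ.exists_bound
  refine (LipschitzWith.of_dist_le' (K := L) fun f g => ?_).continuous
  rw [Real.dist_eq, dist_eq_norm, abs_sub_le_iff]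
  constructor
  · have := hρ.add_le (f - g) g
    rw [sub_add_cancel] at this
    linarith [hL (f - g)]
  · have := hρ.add_le (g - f) f
    rw [sub_add_cancel] at this
    have h2 := hL (g - f)
    rw [norm_sub_rev] at h2
    linarith

theorem nonneg_of_le {l : Lp ℝ p P0 →L[ℝ] ℝ} (hl : ∀ g, l g ≤ ρ g) {f : Lp ℝ p P0} (hf : 0 ≤ f) :
    0 ≤ l f := by
  have h1 := hl (-f)
  have h2 : ρ (-f) ≤ ρ 0 := hρ.mono _ _ (neg_nonpos.2 hf)
  rw [hρ.map_zero] at h2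
  rw [_root_.map_neg] at h1
  linarith

theorem apply_const_of_le {l : Lp ℝ p P0 →L[ℝ] ℝ} (hl : ∀ g, l g ≤ ρ g) :
    l (Lp.const p P0 1) = 1 := by
  have h1 := hl (Lp.const p P0 1)
  have h2 := hl (Lp.const p P0 (-1))
  rw [hρ.map_const] at h1 h2
  rw [_root_.map_neg, _root_.map_neg] at h2
  linarith

end IsCoherentRisk

/-! ### The measure of a positive functional -/

section PositiveFunctional

variable {X : Type*} [MeasurableSpace X] {p : ℝ≥0∞} {P0 : Measure X} [IsProbabilityMeasure P0]
  [hp1 : Fact (1 ≤ p)]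

omit hp1 [IsProbabilityMeasure P0] in
theorem Lp_coeFn_sum {ι : Type*} (I : Finset ι) (f : ι → Lp ℝ p P0) :
    ⇑(∑ i ∈ I, f i) =ᵐ[P0] ∑ i ∈ I, ⇑(f i) := by
  classical
  induction I using Finset.induction_on with
  | empty => simpa using Lp.coeFn_zero ℝ p P0
  | insert i I hi ih =>
    rw [Finset.sum_insert hi, Finset.sum_insert hi]
    exact (Lp.coeFn_add _ _).trans (EventuallyEq.rfl.add ih)

/-- The class in `L_p` of the indicator function of a measurable set. -/
abbrev indLp (p : ℝ≥0∞) (P0 : Measure X) [IsProbabilityMeasure P0] {s : Set X}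
    (hs : MeasurableSet s) : Lp ℝ p P0 :=
  indicatorConstLp p hs (measure_ne_top P0 s) (1 : ℝ)

omit hp1 in
theorem indLp_nonneg {s : Set X} (hs : MeasurableSet s) : 0 ≤ indLp p P0 hs := by
  rw [← Lp.coeFn_nonneg]
  filter_upwards [indicatorConstLp_coeFn (p := p) (hs := hs) (hμs := measure_ne_top P0 s)
    (c := (1 : ℝ))] with x hx
  rw [hx]
  exact Set.indicator_nonneg (fun _ _ => zero_le_one) x

theorem hasSum_indLp (hp : p ≠ ∞) {s : ℕ → Set X} (hs : ∀ i, MeasurableSet (s i))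
    (hd : Pairwise (Function.onFun Disjoint s)) (l : Lp ℝ p P0 →L[ℝ] ℝ)
    (hl : ∀ f, 0 ≤ f → 0 ≤ l f) :
    HasSum (fun i => l (indLp p P0 (hs i))) (l (indLp p P0 (MeasurableSet.iUnion hs))) := by
  rw [hasSum_iff_tendsto_nat_of_nonneg fun i => hl _ (indLp_nonneg (hs i))]
  let t : ℕ → Set X := fun n => ⋃ i ∈ Finset.range n, s i
  have ht : ∀ n, MeasurableSet (t n) := fun n => Finset.measurableSet_biUnion _ fun i _ => hs i
  have hsum : ∀ n, ∑ i ∈ Finset.range n, l (indLp p P0 (hs i)) = l (indLp p P0 (ht n)) := by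
    intro n
    rw [← map_sum]
    congr 1
    induction n with
    | zero =>
      simp only [Finset.range_zero, Finset.sum_empty]
      symm
      have : t 0 = ∅ := by simp [t]
      simp only [indLp, this, indicatorConstLp_empty]
    | succ n ih =>
      rw [Finset.sum_range_succ, ih]
      have hdis : Disjoint (t n) (s n) := by
        simp only [t, Set.disjoint_iUnion_left]
        intro i hi
        exact hd (Finset.mem_range.1 hi).ne
      have hu : t (n + 1) = t n ∪ s n := by
        simp only [t, Finset.range_add_one, Finset.set_biUnion_insert]
        rw [Set.union_comm]
      rw [← indicatorConstLp_disjoint_union (ht n) (hs n) (measure_ne_top _ _)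
        (measure_ne_top _ _) hdis]
      simp only [indLp, hu]
  simp only [hsum]
  refine (l.continuous.tendsto _).comp (tendsto_indicatorConstLp_set hp ?_)
  have hmono : Monotone t := fun m n hmn => Set.biUnion_subset_biUnion_left
    (Finset.coe_subset.2 (Finset.range_mono hmn))
  have hU : ⋃ n, t n = ⋃ i, s i := by
    ext x
    simp only [t, Set.mem_iUnion, Finset.mem_range, exists_prop]
    exact ⟨fun ⟨n, i, _, hx⟩ => ⟨i, hx⟩, fun ⟨i, hx⟩ => ⟨i + 1, i, i.lt_succ_self, hx⟩⟩
  have h1 : ∀ n, P0 (symmDiff (t n) (⋃ i, s i)) = P0 (⋃ i, s i) - P0 (t n) := by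
    intro n
    have hsub : t n ⊆ ⋃ i, s i := hU ▸ Set.subset_iUnion t n
    rw [symmDiff_of_le hsub, measure_sdiff hsub (ht n).nullMeasurableSet (measure_ne_top _ _)]
  simp only [h1]
  have h2 := tendsto_measure_iUnion_atTop (μ := P0) hmono
  rw [hU] at h2
  have h3 := ENNReal.Tendsto.sub (tendsto_const_nhds (x := P0 (⋃ i, s i))) h2
    (Or.inl (measure_ne_top _ _))
  simpa using h3

/-- The measure of a positive functional on `L_p`: the measure of a set is the value of the
functional at its indicator function. -/
def functionalMeasure (hp : p ≠ ∞) (l : Lp ℝ p P0 →L[ℝ] ℝ) (hl : ∀ f, 0 ≤ f → 0 ≤ l f) :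
    Measure X :=
  Measure.ofMeasurable (fun _ hs => ENNReal.ofReal (l (indLp p P0 hs)))
    (by simp [indLp])
    (fun s hs hd => by
      have h := hasSum_indLp hp hs hd l hl
      rw [← h.tsum_eq, ENNReal.ofReal_tsum_of_nonneg (fun i => hl _ (indLp_nonneg (hs i)))
        h.summable])

variable (hp : p ≠ ∞) (l : Lp ℝ p P0 →L[ℝ] ℝ) (hl : ∀ f, 0 ≤ f → 0 ≤ l f)

theorem functionalMeasure_apply {s : Set X} (hs : MeasurableSet s) :
    functionalMeasure hp l hl s = ENNReal.ofReal (l (indLp p P0 hs)) :=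
  Measure.ofMeasurable_apply s hs

theorem functionalMeasure_ac : functionalMeasure hp l hl ≪ P0 := by
  refine Measure.AbsolutelyContinuous.mk fun s hs h0 => ?_
  rw [functionalMeasure_apply hp l hl hs]
  have : indLp p P0 hs = 0 := by
    rw [← norm_eq_zero, indLp, norm_indicatorConstLp (zero_lt_one.trans_le hp1.out).ne' hp]
    have hp0 : p.toReal ≠ 0 := (ENNReal.toReal_pos (zero_lt_one.trans_le hp1.out).ne' hp).ne'
    simp [measureReal_def, h0, hp0]
  simp [this]

theorem functionalMeasure_univ (h1 : l (Lp.const p P0 1) = 1) :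
    functionalMeasure hp l hl Set.univ = 1 := by
  rw [functionalMeasure_apply hp l hl MeasurableSet.univ, indLp, indicatorConstLp_univ, h1]
  simp

/-- The integral is a supremum over simple functions, at which the functional and the integral
agree. -/
theorem lintegral_functionalMeasure_le {f : Lp ℝ p P0} {g : X → ℝ≥0∞}
    (hg : ∀ᵐ x ∂P0, g x ≤ ENNReal.ofReal (f x)) (hf : 0 ≤ f) :
    ∫⁻ x, g x ∂functionalMeasure hp l hl ≤ ENNReal.ofReal (l f) := by
  rw [lintegral_eq_nnreal]
  refine iSup₂_le fun φ hφ => ?_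
  have hm : ∀ r, MeasurableSet (φ ⁻¹' {r}) := fun r => φ.measurableSet_preimage _
  let F : Lp ℝ p P0 := ∑ r ∈ φ.range, (r : ℝ) • indLp p P0 (hm r)
  have hF : (φ.map ((↑) : ℝ≥0 → ℝ≥0∞)).lintegral (functionalMeasure hp l hl) =
      ENNReal.ofReal (l F) := by
    rw [SimpleFunc.map_lintegral, map_sum, ENNReal.ofReal_sum_of_nonneg]
    · refine Finset.sum_congr rfl fun r _ => ?_
      rw [functionalMeasure_apply hp l hl (hm r), _root_.map_smul, smul_eq_mul,
        ENNReal.ofReal_mul (NNReal.coe_nonneg r), ENNReal.ofReal_coe_nnreal]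
    · intro r _
      rw [_root_.map_smul, smul_eq_mul]
      exact mul_nonneg r.2 (hl _ (indLp_nonneg _))
  rw [hF]
  refine ENNReal.ofReal_le_ofReal ?_
  have hle : F ≤ f := by
    rw [← Lp.coeFn_le]
    have hall : ∀ᵐ x ∂P0, ∀ r ∈ φ.range, ((r : ℝ) • indLp p P0 (hm r) : Lp ℝ p P0) x =
        (r : ℝ) * (φ ⁻¹' {r}).indicator (fun _ => (1 : ℝ)) x := by
      rw [eventually_all_finset]
      intro r _
      filter_upwards [Lp.coeFn_smul (r : ℝ) (indLp p P0 (hm r)),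
        indicatorConstLp_coeFn (p := p) (hs := hm r) (hμs := measure_ne_top P0 _) (c := (1 : ℝ))]
        with x h1 h2
      rw [h1, Pi.smul_apply, h2, smul_eq_mul]
    filter_upwards [hall, hg, Lp_coeFn_sum φ.range fun r : ℝ≥0 => (r : ℝ) • indLp p P0 (hm r),
      (Lp.coeFn_nonneg f).2 hf] with x hx hgx hs h0
    have : F x = φ x := by
      rw [hs, Finset.sum_apply, Finset.sum_congr rfl hx, Finset.sum_eq_single (φ x)]
      · simp
      · intro r _ hr
        rw [Set.indicator_of_notMem, mul_zero]
        exact fun h => hr h.symm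
      · exact fun h => absurd (φ.mem_range_self x) h
    rw [this]
    have h2 := (hφ x).trans hgx
    rw [← ENNReal.ofReal_coe_nnreal] at h2
    exact (ENNReal.ofReal_le_ofReal_iff h0).1 h2
  have := hl (f - F) (sub_nonneg.2 hle)
  rw [map_sub] at this
  linarith

theorem lintegral_enorm_functionalMeasure_le (f : Lp ℝ p P0) :
    ∫⁻ x, ‖f x‖ₑ ∂functionalMeasure hp l hl ≤ ENNReal.ofReal (l |f|) := by
  refine lintegral_functionalMeasure_le hp l hl ?_ (abs_nonneg f)
  filter_upwards [Lp.coeFn_abs f] with x hx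
  rw [hx, Real.enorm_eq_ofReal_abs]

theorem lp_integrable_functionalMeasure (f : Lp ℝ p P0) :
    Integrable f (functionalMeasure hp l hl) :=
  ⟨(Lp.aestronglyMeasurable f).mono_ac (functionalMeasure_ac hp l hl),
    (lintegral_enorm_functionalMeasure_le hp l hl f).trans_lt ENNReal.ofReal_lt_top⟩

theorem integral_functionalMeasure (f : Lp ℝ p P0) :
    ∫ x, f x ∂functionalMeasure hp l hl = l f := by
  have hac := functionalMeasure_ac hp l hl
  have hint := lp_integrable_functionalMeasure hp l hl
  have hadd : ∀ f g : Lp ℝ p P0, ∫ x, (f + g : Lp ℝ p P0) x ∂functionalMeasure hp l hl =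
      ∫ x, f x ∂functionalMeasure hp l hl + ∫ x, g x ∂functionalMeasure hp l hl := by
    intro f g
    rw [← integral_add (hint f) (hint g)]
    exact integral_congr_ae (hac.ae_le (Lp.coeFn_add f g))
  have hcont : Continuous fun f : Lp ℝ p P0 => ∫ x, f x ∂functionalMeasure hp l hl := by
    refine (LipschitzWith.of_dist_le' (K := ‖l‖) fun f g => ?_).continuous
    rw [Real.dist_eq, dist_eq_norm]
    have e := hadd (f - g) g
    rw [sub_add_cancel] at e
    rw [e, add_sub_cancel_right, ← Real.norm_eq_abs]
    calc _ ≤ ∫ x, ‖(f - g : Lp ℝ p P0) x‖ ∂functionalMeasure hp l hl :=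
          norm_integral_le_integral_norm _
      _ = (∫⁻ x, ‖(f - g : Lp ℝ p P0) x‖ₑ ∂functionalMeasure hp l hl).toReal :=
          integral_norm_eq_lintegral_enorm (hint _).1
      _ ≤ l |f - g| := ENNReal.toReal_le_of_le_ofReal (hl _ (abs_nonneg _))
          (lintegral_enorm_functionalMeasure_le hp l hl _)
      _ ≤ ‖l‖ * ‖|f - g|‖ := (le_abs_self _).trans (l.le_opNorm _)
      _ = _ := by rw [norm_abs_eq_norm]
  refine Lp.induction hp (fun f => ∫ x, f x ∂functionalMeasure hp l hl = l f) ?_ ?_ ?_ f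
  · intro c s hs hμs
    have h1 : (Lp.simpleFunc.indicatorConst p hs hμs.ne c : Lp ℝ p P0) = c • indLp p P0 hs := by
      ext1
      rw [Lp.simpleFunc.coe_indicatorConst]
      filter_upwards [Lp.coeFn_smul c (indLp p P0 hs),
        indicatorConstLp_coeFn (p := p) (hs := hs) (hμs := measure_ne_top P0 s) (c := (1 : ℝ)),
        indicatorConstLp_coeFn (p := p) (hs := hs) (hμs := hμs.ne) (c := c)] with x h1 h2 h3
      rw [h1, Pi.smul_apply, h2, h3]
      by_cases hx : x ∈ s <;> simp [hx]
    rw [h1, _root_.map_smul]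
    have h2 : ∫ x, (c • indLp p P0 hs : Lp ℝ p P0) x ∂functionalMeasure hp l hl =
        ∫ x, s.indicator (fun _ => c) x ∂functionalMeasure hp l hl := by
      refine integral_congr_ae (hac.ae_le ?_)
      filter_upwards [Lp.coeFn_smul c (indLp p P0 hs),
        indicatorConstLp_coeFn (p := p) (hs := hs) (hμs := measure_ne_top P0 s) (c := (1 : ℝ))]
        with x h1 h2
      rw [h1, Pi.smul_apply, h2]
      by_cases hx : x ∈ s <;> simp [hx]
    rw [h2, integral_indicator hs, setIntegral_const, measureReal_def,
      functionalMeasure_apply hp l hl hs, ENNReal.toReal_ofReal (hl _ (indLp_nonneg hs)),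
      smul_eq_mul, smul_eq_mul, mul_comm]
  · intro f g hf hg _ h1 h2
    rw [hadd, h1, h2, map_add]
  · exact isClosed_eq hcont l.continuous

theorem lintegral_functionalMeasure_le_eLpNorm {g : X → ℝ} (hg : MemLp g p P0) (h0 : 0 ≤ g) :
    ∫⁻ x, ENNReal.ofReal (g x) ∂functionalMeasure hp l hl ≤ ‖l‖ₑ * eLpNorm g p P0 := by
  have hnn : 0 ≤ hg.toLp g := by
    rw [← Lp.coeFn_nonneg]
    filter_upwards [hg.coeFn_toLp] with x hx
    rw [hx]
    exact h0 x
  have h1 : ∀ᵐ x ∂P0, ENNReal.ofReal (g x) ≤ ENNReal.ofReal (hg.toLp g x) := by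
    filter_upwards [hg.coeFn_toLp] with x hx
    rw [hx]
  refine (lintegral_functionalMeasure_le hp l hl h1 hnn).trans ?_
  rw [← Lp.enorm_toLp hg]
  refine le_trans ?_ (l.le_opENorm _)
  rw [Real.enorm_eq_ofReal_abs]
  exact ENNReal.ofReal_le_ofReal (le_abs_self _)

theorem functionalMeasure_isProbabilityMeasure (h1 : l (Lp.const p P0 1) = 1) :
    IsProbabilityMeasure (functionalMeasure hp l hl) :=
  ⟨functionalMeasure_univ hp l hl h1⟩

/-- The converse of Hölder's inequality: the density of the measure of a bounded functional on
`L_p` lies in the conjugate space.  For `p > 1` the functional is tested by the powers with exponent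
`q - 1` of the truncated densities. -/
theorem functionalMeasure_density (h1 : l (Lp.const p P0 1) = 1) :
    MemLp (fun x => ((functionalMeasure hp l hl).rnDeriv P0 x).toReal) p.conjExponent P0 := by
  have := functionalMeasure_isProbabilityMeasure hp l hl h1
  set μ := functionalMeasure hp l hl with hμ
  have hac : μ ≪ P0 := functionalMeasure_ac hp l hl
  have hmeas : Measurable (μ.rnDeriv P0) := Measure.measurable_rnDeriv _ _
  have hfin : ∀ᵐ x ∂P0, μ.rnDeriv P0 x < ∞ := Measure.rnDeriv_lt_top μ P0
  refine ⟨hmeas.ennreal_toReal.aestronglyMeasurable, ?_⟩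
  have hcongr : eLpNorm (fun x => (μ.rnDeriv P0 x).toReal) p.conjExponent P0 =
      eLpNorm (μ.rnDeriv P0) p.conjExponent P0 := by
    refine eLpNorm_congr_enorm_ae ?_
    filter_upwards [hfin] with x hx
    rw [enorm_eq_self, Real.enorm_eq_ofReal_abs, abs_of_nonneg ENNReal.toReal_nonneg,
      ENNReal.ofReal_toReal hx.ne]
  rw [hcongr]
  rcases hp1.out.eq_or_lt with h | hlt
  · -- `p = 1`: the functional is tested by indicator functions
    subst h
    have hq : ENNReal.conjExponent 1 = ∞ := by simp [ENNReal.conjExponent]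
    rw [hq, eLpNorm_exponent_top]
    have hle : μ.rnDeriv P0 ≤ᵐ[P0] fun _ => ‖l‖ₑ := by
      refine ae_le_of_forall_setLIntegral_le_of_sigmaFinite hmeas fun s hs _ => ?_
      rw [Measure.setLIntegral_rnDeriv hac, setLIntegral_const]
      have hi : MemLp (s.indicator fun _ => (1 : ℝ)) 1 P0 :=
        memLp_indicator_const 1 hs 1 (Or.inr (measure_ne_top _ _))
      have hb := lintegral_functionalMeasure_le_eLpNorm hp l hl hi
        (Set.indicator_nonneg fun _ _ => zero_le_one)
      rw [eLpNorm_indicator_const hs one_ne_zero ENNReal.one_ne_top] at hb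
      have e : ∀ x, ENNReal.ofReal (s.indicator (fun _ => (1 : ℝ)) x) =
          s.indicator (fun _ => (1 : ℝ≥0∞)) x := by
        intro x
        by_cases hx : x ∈ s <;> simp [hx]
      simp only [e] at hb
      rw [lintegral_indicator hs] at hb
      simpa using hb
    have hle' : ∀ᵐ x ∂P0, ‖μ.rnDeriv P0 x‖ₑ ≤ ‖l‖ₑ := by
      filter_upwards [hle] with x hx
      simpa using hx
    exact (eLpNormEssSup_le_of_ae_enorm_bound hle').trans_lt enorm_lt_top
  · -- `p > 1`
    set r := p.toReal with hr
    have hr1 : 1 < r := by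
      rw [hr, ← ENNReal.toReal_one]
      exact (ENNReal.toReal_lt_toReal ENNReal.one_ne_top hp).2 hlt
    have hrq : r.HolderConjugate p.conjExponent.toReal := ENNReal.HolderConjugate.toReal hr1
    set q := p.conjExponent.toReal with hq
    have hq0 : p.conjExponent ≠ 0 := by simp [ENNReal.conjExponent]
    have hqt : p.conjExponent ≠ ∞ := by
      intro h
      rw [hq, h] at hrq
      exact absurd hrq.symm.lt (by simp)
    have hp0 : p ≠ 0 := (zero_lt_one.trans hlt).ne'
    have hqpos : 0 < q := hrq.symm.pos
    have hq1 : 0 < q - 1 := sub_pos.2 hrq.symm.lt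
    rw [eLpNorm_lt_top_iff_lintegral_rpow_enorm_lt_top hq0 hqt]
    simp only [enorm_eq_self]
    let h : ℕ → X → ℝ≥0∞ := fun n x => min (μ.rnDeriv P0 x) n
    have hhm : ∀ n, Measurable (h n) := fun n => hmeas.min measurable_const
    have hbound : ∀ n, ∫⁻ x, h n x ^ q ∂P0 ≤ ‖l‖ₑ ^ q := by
      intro n
      set I := ∫⁻ x, h n x ^ q ∂P0 with hI
      have hhn : ∀ x, h n x ≤ n := fun x => min_le_right _ _
      have hht : ∀ x, h n x ≠ ∞ := fun x => ne_top_of_le_ne_top (ENNReal.natCast_ne_top n) (hhn x)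
      have hIfin : I ≠ ∞ := by
        have : I ≤ ∫⁻ _, (n : ℝ≥0∞) ^ q ∂P0 :=
          lintegral_mono fun x => ENNReal.rpow_le_rpow (hhn x) hqpos.le
        rw [lintegral_const, measure_univ, mul_one] at this
        exact ne_top_of_le_ne_top (ENNReal.rpow_ne_top_of_nonneg hqpos.le
          (ENNReal.natCast_ne_top n)) this
      let g : X → ℝ := fun x => (h n x ^ (q - 1)).toReal
      have hgt : ∀ x, h n x ^ (q - 1) ≠ ∞ := fun x => ENNReal.rpow_ne_top_of_nonneg hq1.le (hht x)
      have hgm : Measurable g := ((hhm n).pow_const _).ennreal_toReal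
      have hgnorm : eLpNorm g p P0 = I ^ (1 / r) := by
        rw [eLpNorm_eq_lintegral_rpow_enorm_toReal hp0 hp]
        congr 1
        refine lintegral_congr fun x => ?_
        rw [Real.enorm_eq_ofReal_abs, abs_of_nonneg ENNReal.toReal_nonneg,
          ENNReal.ofReal_toReal (hgt x), ← ENNReal.rpow_mul, ← hr]
        congr 1
        exact hrq.symm.sub_one_mul_conj
      have hg : MemLp g p P0 := by
        refine ⟨hgm.aestronglyMeasurable, ?_⟩
        rw [hgnorm]
        exact (ENNReal.rpow_ne_top_of_nonneg (by positivity) hIfin).lt_top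
      have h2 := lintegral_functionalMeasure_le_eLpNorm hp l hl hg fun x => ENNReal.toReal_nonneg
      rw [hgnorm, ← hμ] at h2
      have h3 : I ≤ ∫⁻ x, ENNReal.ofReal (g x) ∂μ := by
        rw [← lintegral_rnDeriv_mul hac
          (hgm.ennreal_ofReal.aemeasurable), hI]
        refine lintegral_mono fun x => ?_
        change h n x ^ q ≤ μ.rnDeriv P0 x * ENNReal.ofReal (h n x ^ (q - 1)).toReal
        rw [ENNReal.ofReal_toReal (hgt x)]
        calc h n x ^ q = h n x ^ (1 + (q - 1)) := by congr 1; ring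
          _ = h n x * h n x ^ (q - 1) := by
            rw [ENNReal.rpow_add_of_nonneg _ _ zero_le_one hq1.le, ENNReal.rpow_one]
          _ ≤ _ := by gcongr; exact min_le_left _ _
      have h4 : I ≤ ‖l‖ₑ * I ^ (1 / r) := h3.trans h2
      rcases eq_or_ne I 0 with h0 | h0
      · rw [h0]; exact zero_le
      have h5 : I ^ (1 / q) ≤ ‖l‖ₑ := by
        have e : (1 : ℝ) / q = 1 - 1 / r := by
          have := hrq.inv_add_inv_eq_one
          rw [one_div, one_div]; linarith
        rw [e, ENNReal.rpow_sub _ _ h0 hIfin, ENNReal.rpow_one]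
        exact ENNReal.div_le_of_le_mul h4
      calc I = (I ^ (1 / q)) ^ q := by
            rw [← ENNReal.rpow_mul, one_div_mul_cancel hqpos.ne', ENNReal.rpow_one]
        _ ≤ _ := ENNReal.rpow_le_rpow h5 hqpos.le
    have hlim : ∫⁻ x, μ.rnDeriv P0 x ^ q ∂P0 = ⨆ n, ∫⁻ x, h n x ^ q ∂P0 := by
      rw [← lintegral_iSup (fun n => (hhm n).pow_const _)
        (fun m n hmn x =>
          ENNReal.rpow_le_rpow (min_le_min_left _ (by exact_mod_cast hmn)) hqpos.le)]
      refine lintegral_congr_ae ?_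
      filter_upwards [hfin] with x hx
      refine le_antisymm ?_ (iSup_le fun n => ENNReal.rpow_le_rpow (min_le_left _ _) hqpos.le)
      obtain ⟨n, hn⟩ := ENNReal.exists_nat_gt hx.ne
      refine le_trans (le_of_eq ?_) (le_iSup _ n)
      simp only [h, min_eq_left hn.le]
    rw [hlim]
    exact (iSup_le hbound).trans_lt (ENNReal.rpow_lt_top_of_nonneg hqpos.le enorm_ne_top)

/-- A positive normalized functional on `L_p` is the pairing with a measure in `𝓜`. -/
theorem exists_dualProb_pairing_eq (hp : p ≠ ∞) (l : Lp ℝ p P0 →L[ℝ] ℝ)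
    (hl : ∀ f, 0 ≤ f → 0 ≤ l f) (h1 : l (Lp.const p P0 1) = 1) :
    ∃ μ : DualProb p P0, ∀ f, pairing f μ = l f :=
  ⟨⟨functionalMeasure hp l hl, functionalMeasure_isProbabilityMeasure hp l hl h1,
    functionalMeasure_ac hp l hl, functionalMeasure_density hp l hl h1⟩,
    integral_functionalMeasure hp l hl⟩

end PositiveFunctional

section DualProb

variable {X : Type*} [MeasurableSpace X] {p : ℝ≥0∞} {P0 : Measure X} [IsProbabilityMeasure P0]
  [hp1 : Fact (1 ≤ p)]

instance (μ : DualProb p P0) : IsProbabilityMeasure μ.toMeasure := μ.isProb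

/-- By Hölder's inequality, `L_p(P0)` consists of functions integrable for the measures in `𝓜`. -/
theorem DualProb.integrable (μ : DualProb p P0) {f : X → ℝ} (hf : MemLp f p P0) :
    Integrable f μ.toMeasure := by
  rw [← integrable_rnDeriv_smul_iff μ.ac]
  exact μ.density.integrable_mul hf (p := p.conjExponent) (q := p)

omit [IsProbabilityMeasure P0] hp1 in
theorem pairing_toLp (μ : DualProb p P0) {f : X → ℝ} (hf : MemLp f p P0) :
    pairing (hf.toLp f) μ = ∫ y, f y ∂μ.toMeasure :=
  integral_congr_ae (μ.ac.ae_le hf.coeFn_toLp)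

end DualProb

/-! ### Functions as elements of `L_p` -/

section Functions

variable {X : Type*} [MeasurableSpace X] {p : ℝ≥0∞} {P0 : Measure X}

theorem toV_of_memLp {f : X → ℝ} (hf : MemLp f p P0) : toV p P0 f = hf.toLp f := dif_pos hf

theorem toV_coeFn {f : X → ℝ} (hf : MemLp f p P0) : toV p P0 f =ᵐ[P0] f := by
  rw [toV_of_memLp hf]
  exact hf.coeFn_toLp

theorem toV_congr {f g : X → ℝ} (h : f =ᵐ[P0] g) : toV p P0 f = toV p P0 g := by
  by_cases hf : MemLp f p P0
  · have hg : MemLp g p P0 := (memLp_congr_ae h).1 hf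
    rw [toV_of_memLp hf, toV_of_memLp hg]
    exact (MemLp.toLp_eq_toLp_iff hf hg).2 h
  · have hg : ¬ MemLp g p P0 := fun hg => hf ((memLp_congr_ae h).2 hg)
    rw [toV, toV, dif_neg hf, dif_neg hg]

variable [IsProbabilityMeasure P0] [hp1 : Fact (1 ≤ p)]

omit [IsProbabilityMeasure P0] in
/-- Dominated convergence in `L_p`. -/
theorem tendsto_toV_of_dominated (hp : p ≠ ∞) {f : ℕ → X → ℝ} {g B : X → ℝ}
    (hf : ∀ n, MemLp (f n) p P0) (hg : MemLp g p P0) (hB : MemLp B p P0)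
    (hfB : ∀ n x, |f n x| ≤ B x) (hlim : ∀ x, Tendsto (fun n => f n x) atTop (𝓝 (g x))) :
    Tendsto (fun n => toV p P0 (f n)) atTop (𝓝 (toV p P0 g)) := by
  have hp0 : p ≠ 0 := (zero_lt_one.trans_le hp1.out).ne'
  have hpr : 0 < p.toReal := ENNReal.toReal_pos hp0 hp
  simp only [toV_of_memLp hg, fun n => toV_of_memLp (hf n)]
  rw [Lp.tendsto_Lp_iff_tendsto_eLpNorm'']
  have hgB : ∀ x, |g x| ≤ B x := fun x =>
    le_of_tendsto' (hlim x).abs fun n => hfB n x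
  have hint : Tendsto (fun n => ∫⁻ x, ‖f n x - g x‖ₑ ^ p.toReal ∂P0) atTop (𝓝 (∫⁻ _, 0 ∂P0)) := by
    refine tendsto_lintegral_of_dominated_convergence' (fun x => ‖2 * B x‖ₑ ^ p.toReal) ?_ ?_ ?_ ?_
    · exact fun n => ((hf n).sub hg).1.enorm.pow_const _
    · refine fun n => Eventually.of_forall fun x => ?_
      refine ENNReal.rpow_le_rpow ?_ hpr.le
      rw [enorm_le_iff_norm_le, Real.norm_eq_abs, Real.norm_eq_abs]
      calc |f n x - g x| ≤ |f n x| + |g x| := abs_sub _ _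
        _ ≤ 2 * B x := by linarith [hfB n x, hgB x]
        _ ≤ _ := le_abs_self _
    · exact (lintegral_rpow_enorm_lt_top_of_eLpNorm_lt_top hp0 hp (hB.const_mul 2).2).ne
    · refine Eventually.of_forall fun x => ?_
      have h1 : Tendsto (fun n => f n x - g x) atTop (𝓝 0) := by
        simpa using (hlim x).sub_const (g x)
      have h2 := h1.enorm.ennrpow_const p.toReal
      simpa [hpr] using h2
  have h3 := hint.ennrpow_const (1 / p.toReal)
  simp only [lintegral_zero, one_div, ENNReal.zero_rpow_of_pos (inv_pos.2 hpr)] at h3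
  refine h3.congr fun n => ?_
  rw [eLpNorm_eq_lintegral_rpow_enorm_toReal hp0 hp, one_div]
  rfl

/-- A jointly measurable function whose sections lie in `L_p` defines a Borel map into `L_p`. -/
theorem measurable_toV [MeasurableSpace.CountablyGenerated X] (hp : p ≠ ∞) {H : Type*}
    [MeasurableSpace H] {F : H → X → ℝ} (hF : Measurable (Function.uncurry F))
    (hFp : ∀ h, MemLp (F h) p P0) :
    @Measurable H (Lp ℝ p P0) _ (borel _) fun h => toV p P0 (F h) := by
  have hp0 : p ≠ 0 := (zero_lt_one.trans_le hp1.out).ne'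
  have : Fact (p ≠ ∞) := ⟨hp⟩
  have hbasis : TopologicalSpace.IsTopologicalBasis
      {s : Set (Lp ℝ p P0) | ∃ g r, s = Metric.ball g r} := by
    refine TopologicalSpace.isTopologicalBasis_of_isOpen_of_nhds ?_ ?_
    · rintro _ ⟨g, r, rfl⟩
      exact Metric.isOpen_ball
    · intro g O hg hO
      obtain ⟨r, hr, hsub⟩ := Metric.isOpen_iff.1 hO g hg
      exact ⟨_, ⟨g, r, rfl⟩, Metric.mem_ball_self hr, hsub⟩
  rw [hbasis.borel_eq_generateFrom]
  refine measurable_generateFrom ?_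
  rintro _ ⟨g, r, rfl⟩
  have hdist : Measurable fun h => (∫⁻ x, ‖F h x - g x‖ₑ ^ p.toReal ∂P0) ^ (1 / p.toReal) := by
    have hg : Measurable g := (Lp.stronglyMeasurable g).measurable
    have : Measurable fun z : H × X => ‖Function.uncurry F z - g z.2‖ₑ ^ p.toReal :=
      ((hF.sub (hg.comp measurable_snd)).enorm).pow_const _
    exact (this.lintegral_prod_right').pow_const _
  have heq : (fun h => toV p P0 (F h)) ⁻¹' Metric.ball g r =
      {h | ((∫⁻ x, ‖F h x - g x‖ₑ ^ p.toReal ∂P0) ^ (1 / p.toReal)).toReal < r} := by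
    ext h
    simp only [Set.mem_preimage, Metric.mem_ball, Set.mem_ofPred_eq]
    rw [dist_eq_norm, Lp.norm_def, ← eLpNorm_eq_lintegral_rpow_enorm_toReal hp0 hp]
    have : eLpNorm (toV p P0 (F h) - g : Lp ℝ p P0) p P0 = eLpNorm (fun x => F h x - g x) p P0 := by
      refine eLpNorm_congr_ae ?_
      filter_upwards [Lp.coeFn_sub (toV p P0 (F h)) g, toV_coeFn (hFp h)] with x h1 h2
      rw [h1, Pi.sub_apply, h2]
    rw [this]
  rw [heq]
  exact measurableSet_lt hdist.ennreal_toReal measurable_const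

end Functions

/-! ### The support function of the subdifferential -/

section Subgradient

theorem measurable_faceSeq {Y E : Type*} [MeasurableSpace Y] [AddCommGroup E] {s : Y → E → ℝ}
    (hs : ∀ y, IsNatSublinear (s y)) (hm : ∀ g, Measurable fun y => s y g) (d : ℕ → E)
    (n : ℕ) (g : E) : Measurable fun y => faceSeq (s y) d n g := by
  induction n generalizing g with
  | zero => exact hm g
  | succ n ih =>
    refine measurable_of_tendsto_metrizable (fun k => (ih (k • d n + g)).sub
      ((ih (d n)).const_mul (k : ℝ))) ?_
    exact tendsto_pi_nhds.2 fun y => ((hs y).faceSeq d n).face_tendsto (d n) g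

theorem measurable_faceLim {Y E : Type*} [MeasurableSpace Y] [AddCommGroup E] {s : Y → E → ℝ}
    (hs : ∀ y, IsNatSublinear (s y)) (hm : ∀ g, Measurable fun y => s y g) (d : ℕ → E)
    (g : E) : Measurable fun y => faceLim (s y) d g :=
  measurable_of_tendsto_metrizable (fun n => measurable_faceSeq hs hm d n g)
    (tendsto_pi_nhds.2 fun y => (hs y).faceLim_tendsto d g)

variable {X : Type*} [MeasurableSpace X] {p : ℝ≥0∞} {P0 : Measure X} [IsProbabilityMeasure P0]
  [hp1 : Fact (1 ≤ p)]

/-- Exposing the subdifferential of a coherent risk measure by a dense sequence of directions leaves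
a single measure, at which the risk of the first direction is attained. -/
theorem IsCoherentRisk.exists_dualProb_faceLim (hp : p ≠ ∞) {ρ : Lp ℝ p P0 → ℝ}
    (hρ : IsCoherentRisk ρ) {d : ℕ → Lp ℝ p P0} (hd : DenseRange d) :
    ∃ μ : DualProb p P0, (∀ g, pairing g μ = faceLim ρ d g) ∧ (∀ g, pairing g μ ≤ ρ g) ∧
      pairing (d 0) μ = ρ (d 0) := by
  obtain ⟨L, -, hL⟩ := hρ.exists_bound
  have hs := hρ.isNatSublinear
  obtain ⟨l, hl⟩ := hs.exists_eq_faceLim hL hd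
  have hle : ∀ g, l g ≤ ρ g := fun g => (hl g).trans_le (hs.faceLim_le d g 0)
  obtain ⟨μ, hμ⟩ := exists_dualProb_pairing_eq hp l (fun f hf => hρ.nonneg_of_le hle hf)
    (hρ.apply_const_of_le hle)
  refine ⟨μ, fun g => (hμ g).trans (hl g), fun g => (hμ g).trans_le (hle g), ?_⟩
  rw [hμ, hl]
  exact hs.faceLim_apply d 0

/-- A dense sequence that starts at a given point. -/
theorem exists_denseRange_zero_eq {E : Type*} [TopologicalSpace E]
    [TopologicalSpace.SeparableSpace E] (f : E) : ∃ d : ℕ → E, DenseRange d ∧ d 0 = f := by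
  have : Nonempty E := ⟨f⟩
  refine ⟨fun n => Nat.casesOn n f (TopologicalSpace.denseSeq E), ?_, rfl⟩
  refine (TopologicalSpace.denseRange_denseSeq E).mono ?_
  rintro _ ⟨n, rfl⟩
  exact ⟨n + 1, rfl⟩

/-- A measurable family of coherent risk measures has a kernel of subgradients at which the risks
of a given function are attained. -/
theorem exists_kernel_subgradient [MeasurableSpace.CountablyGenerated X] (hp : p ≠ ∞) {Y : Type*}
    [MeasurableSpace Y] {s : Y → Lp ℝ p P0 → ℝ} (hs : ∀ y, IsCoherentRisk (s y))
    (hm : ∀ g, Measurable fun y => s y g) (f : Lp ℝ p P0) :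
    ∃ N : Kernel Y X, ∀ y, ∃ μ : DualProb p P0, N y = μ.toMeasure ∧
      (∀ g, pairing g μ ≤ s y g) ∧ pairing f μ = s y f := by
  have : Fact (p ≠ ∞) := ⟨hp⟩
  obtain ⟨d, hd, hd0⟩ := exists_denseRange_zero_eq f
  choose μ hlim hle hμ0 using fun y => (hs y).exists_dualProb_faceLim hp hd
  refine ⟨⟨fun y => (μ y).toMeasure, ?_⟩, fun y => ⟨μ y, rfl, hle y, hd0 ▸ hμ0 y⟩⟩
  refine Measure.measurable_of_measurable_coe _ fun B hB => ?_
  have hval : ∀ y, (μ y).toMeasure B = ENNReal.ofReal (faceLim (s y) d (indLp p P0 hB)) := by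
    intro y
    rw [← hlim y, pairing]
    have : ∫ x, indLp p P0 hB x ∂(μ y).toMeasure =
        ∫ x, B.indicator (fun _ => (1 : ℝ)) x ∂(μ y).toMeasure :=
      integral_congr_ae ((μ y).ac.ae_le indicatorConstLp_coeFn)
    rw [this, integral_indicator hB, setIntegral_const, smul_eq_mul, mul_one, measureReal_def,
      ENNReal.ofReal_toReal (measure_ne_top _ _)]
  simp only [hval]
  exact (measurable_faceLim (fun y => (hs y).isNatSublinear) hm d _).ennreal_ofReal

end Subgradient

namespace ControlledModel

/-! ### The one-step risk of functions of the next state -/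

section OneStep

variable {X A : Type*} [MeasurableSpace X] [TopologicalSpace A] [MeasurableSpace A]
  {M : ControlledModel X A} {p : ℝ≥0∞} [Fact (1 ≤ p)] {P0 : Measure X} [IsProbabilityMeasure P0]
  {σ : Lp ℝ p P0 → X → DualProb p P0 → ℝ} (hσ : IsRiskTransition σ) (h0 : M.G0 p P0)
include hσ

theorem riskAt_mono {f g : X → ℝ} (hf : MemLp f p P0) (hg : MemLp g p P0) (hfg : ∀ y, f y ≤ g y)
    (z : M.Graph) : M.riskAt σ h0 f z ≤ M.riskAt σ h0 g z := by
  refine (hσ.coherent _ _).mono _ _ ?_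
  rw [← Lp.coeFn_le]
  filter_upwards [toV_coeFn hf, toV_coeFn hg] with y h1 h2
  rw [h1, h2]
  exact hfg y

theorem riskAt_add_le {f g : X → ℝ} (hf : MemLp f p P0) (hg : MemLp g p P0) (z : M.Graph) :
    M.riskAt σ h0 (fun y => f y + g y) z ≤ M.riskAt σ h0 f z + M.riskAt σ h0 g z := by
  have : toV p P0 (fun y => f y + g y) = toV p P0 f + toV p P0 g := by
    rw [toV_of_memLp hf, toV_of_memLp hg, ← MemLp.toLp_add, ← toV_of_memLp]
    rfl
  rw [riskAt, this]
  exact (hσ.coherent _ _).add_le _ _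

theorem riskAt_const_mul {f : X → ℝ} (hf : MemLp f p P0) {b : ℝ} (hb : 0 ≤ b) (z : M.Graph) :
    M.riskAt σ h0 (fun y => b * f y) z = b * M.riskAt σ h0 f z := by
  have : toV p P0 (fun y => b * f y) = b • toV p P0 f := by
    rw [toV_of_memLp hf, ← MemLp.toLp_const_smul, ← toV_of_memLp]
    rfl
  rw [riskAt, this]
  exact (hσ.coherent _ _).pos_homog b hb _

theorem riskAt_const (a : ℝ) (z : M.Graph) : M.riskAt σ h0 (fun _ => a) z = a := by
  have : toV p P0 (fun _ => a) = Lp.const p P0 a := toV_of_memLp (memLp_const a)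
  rw [riskAt, this]
  exact (hσ.coherent _ _).map_const a

/-- Perturbing a function by a nonnegative multiple of `W` perturbs its risk at most by the same
multiple of the risk of `W`. -/
theorem riskAt_le_add_mul {f g W : X → ℝ} (hf : MemLp f p P0) (hg : MemLp g p P0)
    (hW : MemLp W p P0) {a : ℝ} (ha : 0 ≤ a) (h : ∀ y, f y ≤ g y + a * W y) (z : M.Graph) :
    M.riskAt σ h0 f z ≤ M.riskAt σ h0 g z + a * M.riskAt σ h0 W z := by
  rw [← riskAt_const_mul hσ h0 hW ha]
  exact (riskAt_mono hσ h0 hf (hg.add (hW.const_mul a)) h z).trans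
    (riskAt_add_le hσ h0 hg (hW.const_mul a) z)

theorem riskAt_nonneg {f : X → ℝ} (hf : MemLp f p P0) (h : ∀ y, 0 ≤ f y) (z : M.Graph) :
    0 ≤ M.riskAt σ h0 f z := by
  rw [← riskAt_const hσ h0 0 z]
  exact riskAt_mono hσ h0 (memLp_const 0) hf h z

theorem tendsto_riskAt (hp : p ≠ ∞) {f : ℕ → X → ℝ} {g B : X → ℝ}
    (hf : ∀ n, MemLp (f n) p P0) (hg : MemLp g p P0) (hB : MemLp B p P0)
    (hfB : ∀ n x, |f n x| ≤ B x) (hlim : ∀ x, Tendsto (fun n => f n x) atTop (𝓝 (g x)))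
    (z : M.Graph) :
    Tendsto (fun n => M.riskAt σ h0 (f n) z) atTop (𝓝 (M.riskAt σ h0 g z)) :=
  ((hσ.coherent _ _).continuous.tendsto _).comp (tendsto_toV_of_dominated hp hf hg hB hfB hlim)

/-- At the absorbing state the next state is certain; law invariance makes its risk equal to the
value there. -/
theorem riskAt_absorbing [MeasurableSingletonClass X] {f : X → ℝ} (hf : MemLp f p P0)
    (z : M.Graph) (hz : z.1.1 = M.xA) : M.riskAt σ h0 f z = f M.xA := by
  rw [← riskAt_const hσ h0 (f M.xA) z]
  refine hσ.law_invariant _ _ _ _ (fun η => measure_congr ?_) _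
  have hQ : M.Q z {M.xA} = 1 := by
    obtain ⟨⟨x, u⟩, hu⟩ := z
    obtain rfl : x = M.xA := hz
    exact M.absorbing u hu
  have := M.Q_markov.isProbabilityMeasure z
  have hae : ∀ᵐ y ∂M.Q z, y = M.xA := by
    rw [ae_iff, ← Set.compl_ofPred]
    exact (prob_compl_eq_zero_iff (measurableSet_singleton _)).2 hQ
  filter_upwards [hae, (h0 z).1.ae_le (toV_coeFn hf),
    (h0 z).1.ae_le (toV_coeFn (memLp_const (f M.xA)))] with y h1 h2 h3
  change (toV p P0 f y ≤ η) = (toV p P0 (fun _ => f M.xA) y ≤ η)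
  rw [h2, h3, h1]

end OneStep

/-! ### Measurability and semicontinuity of the one-step risk -/

section Regularity

set_option linter.unusedSectionVars false

variable {X A : Type*} [TopologicalSpace X] [TopologicalSpace.MetrizableSpace X]
  [SecondCountableTopology X] [MeasurableSpace X] [BorelSpace X] [StandardBorelSpace X]
  [TopologicalSpace A] [TopologicalSpace.MetrizableSpace A] [SecondCountableTopology A]
  [MeasurableSpace A] [BorelSpace A]
  {M : ControlledModel X A} {p : ℝ≥0∞} [Fact (1 ≤ p)] {P0 : Measure X} [IsProbabilityMeasure P0]
  {σ : Lp ℝ p P0 → X → DualProb p P0 → ℝ}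

theorem continuous_QV (h0 : M.G0 p P0) (h1 : M.G1 p P0) : Continuous (M.QV h0) :=
  continuous_induced_rng.2 (continuous_pi fun f => h1 f)

theorem measurable_QV (h0 : M.G0 p P0) (h1 : M.G1 p P0) : Measurable (M.QV h0) := by
  have : BorelSpace (DualProb p P0) := ⟨rfl⟩
  exact (continuous_QV h0 h1).measurable

variable (hσ : IsRiskTransition σ) (h0 : M.G0 p P0) (h1 : M.G1 p P0)
include hσ h1

theorem measurable_riskAt (hp : p ≠ ∞) {H : Type*} [MeasurableSpace H] {F : H → X → ℝ}
    (hF : Measurable (Function.uncurry F)) (hFp : ∀ h, MemLp (F h) p P0) {ζ : H → M.Graph}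
    (hζ : Measurable ζ) : Measurable fun h => M.riskAt σ h0 (F h) (ζ h) := by
  let : MeasurableSpace (Lp ℝ p P0) := borel _
  have h2 : Measurable fun h => (toV p P0 (F h), ((ζ h).1.1, M.QV h0 (ζ h))) :=
    (measurable_toV hp hF hFp).prodMk
      ((measurable_fst.comp (measurable_subtype_coe.comp hζ)).prodMk
        ((measurable_QV h0 h1).comp hζ))
  exact hσ.measurable.comp h2

theorem exists_kernel_riskMultikernel (hp : p ≠ ∞) (π : M.DecisionRule) {f : X → ℝ}
    (hf : MemLp f p P0) : ∃ N : Kernel X X, ∀ x, N x ∈ M.riskMultikernel σ h0 π x ∧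
      Integrable f (N x) ∧ ∫ y, f y ∂N x = M.riskAt σ h0 f (π.pair x) := by
  have hπ : Measurable π.pair := (measurable_id.prodMk π.measurable).subtype_mk
  have hm : ∀ g : Lp ℝ p P0, Measurable fun x => σ g x (M.QV h0 (π.pair x)) := by
    intro g
    let : MeasurableSpace (Lp ℝ p P0) := borel _
    exact hσ.measurable.comp (measurable_const.prodMk
      (measurable_id.prodMk ((measurable_QV h0 h1).comp hπ)))
  obtain ⟨N, hN⟩ := exists_kernel_subgradient hp
    (fun x => hσ.coherent x (M.QV h0 (π.pair x))) hm (toV p P0 f)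
  refine ⟨N, fun x => ?_⟩
  obtain ⟨μ, hNμ, hle, heq⟩ := hN x
  refine ⟨⟨μ, fun g => ?_, hNμ.symm⟩, hNμ ▸ μ.integrable hf, ?_⟩
  · rw [(hσ.coherent _ _).map_zero, zero_add]
    exact hle g
  · rw [hNμ, ← pairing_toLp μ hf, ← toV_of_memLp hf]
    exact heq

variable (h2 : G2 σ)
include h2

/-- The risk of a fixed function is lower semicontinuous in the state and the control: it is the
supremum of pairings over a lower semicontinuous multifunction. -/
theorem eventually_lt_riskAt (hp : p ≠ ∞) (f : X → ℝ) {z : ℕ → M.Graph} {z₀ : M.Graph}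
    (hz : Tendsto z atTop (𝓝 z₀)) {a : ℝ} (ha : a < M.riskAt σ h0 f z₀) :
    ∀ᶠ k in atTop, a < M.riskAt σ h0 f (z k) := by
  have : Fact (p ≠ ∞) := ⟨hp⟩
  obtain ⟨d, hd, hd0⟩ := exists_denseRange_zero_eq (toV p P0 f)
  obtain ⟨μ, -, hle, heq⟩ := (hσ.coherent z₀.1.1 (M.QV h0 z₀)).exists_dualProb_faceLim hp hd
  have hlim : Tendsto (fun k => ((z k).1.1, M.QV h0 (z k))) atTop (𝓝 (z₀.1.1, M.QV h0 z₀)) :=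
    (((continuous_fst.comp continuous_subtype_val).prodMk
      (continuous_QV h0 h1)).tendsto z₀).comp hz
  have hO : IsOpen {ν : DualProb p P0 | a < pairing (toV p P0 f) ν} := by
    refine isOpen_lt continuous_const ?_
    have : Continuous fun (ν : DualProb p P0) (g : Lp ℝ p P0) => pairing g ν :=
      continuous_induced_dom
    exact (continuous_pi_iff.1 this) (toV p P0 f)
  have hev := h2 _ _ hlim _ hO ⟨μ, fun g => ?_, ?_⟩
  · filter_upwards [hev] with k hk
    obtain ⟨ν, hν, hlt⟩ := hk
    have h3 := hν (toV p P0 f)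
    rw [(hσ.coherent _ _).map_zero, zero_add] at h3
    exact lt_of_lt_of_le hlt h3
  · rw [(hσ.coherent _ _).map_zero, zero_add]
    exact hle g
  · change a < pairing _ μ
    rw [← hd0, heq, hd0]
    exact ha

/-- Lower semicontinuity jointly in the function, the state and the control, under a common lower
bound.  The function is replaced by the increasing sequence of the lower envelopes
`inf_{k ≥ j} min (f k) f₀`, so that only fixed functions have to be considered. -/
theorem eventually_lt_riskAt_seq (hp : p ≠ ∞) {f : ℕ → X → ℝ} {f₀ B : X → ℝ}
    (hf : ∀ k, MemLp (f k) p P0) (hfm : ∀ k, Measurable (f k)) (hf₀ : MemLp f₀ p P0)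
    (hf₀m : Measurable f₀)
    (hB : MemLp B p P0) (hfB : ∀ k x, -B x ≤ f k x) (hf₀B : ∀ x, |f₀ x| ≤ B x)
    (hlsc : ∀ x, ∀ a < f₀ x, ∀ᶠ k in atTop, a < f k x)
    {z : ℕ → M.Graph} {z₀ : M.Graph}
    (hz : Tendsto z atTop (𝓝 z₀)) {a : ℝ} (ha : a < M.riskAt σ h0 f₀ z₀) :
    ∀ᶠ k in atTop, a < M.riskAt σ h0 (f k) (z k) := by
  let g : ℕ → X → ℝ := fun k x => min (f k x) (f₀ x)
  let h : ℕ → X → ℝ := fun j x => ⨅ k : ℕ, g (j + k) x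
  have hgB : ∀ k x, -B x ≤ g k x := fun k x => le_min (hfB k x) (neg_le_of_abs_le (hf₀B x))
  have hbdd : ∀ j x, BddBelow (Set.range fun k => g (j + k) x) := fun j x =>
    ⟨-B x, by rintro _ ⟨k, rfl⟩; exact hgB _ x⟩
  have hhf : ∀ j k, j ≤ k → ∀ x, h j x ≤ g k x := by
    intro j k hjk x
    have := ciInf_le (hbdd j x) (k - j)
    rwa [Nat.add_sub_cancel' hjk] at this
  have hhB : ∀ j x, |h j x| ≤ B x := by
    intro j x
    refine abs_le.2 ⟨le_ciInf fun k => hgB _ x, ?_⟩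
    exact (hhf j j le_rfl x).trans ((min_le_right _ _).trans (le_of_abs_le (hf₀B x)))
  have hhm : ∀ j, Measurable (h j) := fun j =>
    Measurable.iInf fun k => (hfm (j + k)).min hf₀m
  have hhp : ∀ j, MemLp (h j) p P0 := fun j =>
    hB.mono' (hhm j).aestronglyMeasurable (Eventually.of_forall (hhB j))
  have hlim : ∀ x, Tendsto (fun j => h j x) atTop (𝓝 (f₀ x)) := by
    intro x
    refine tendsto_order.2 ⟨fun b hb => ?_, fun b hb => ?_⟩
    · obtain ⟨c, hbc, hc⟩ := exists_between hb
      obtain ⟨j, hj⟩ := eventually_atTop.1 (hlsc x c hc)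
      filter_upwards [eventually_ge_atTop j] with i hi
      refine hbc.trans_le (le_ciInf fun k => ?_)
      exact le_min (hj _ (hi.trans (Nat.le_add_right _ _))).le hc.le
    · exact Eventually.of_forall fun j =>
        ((hhf j j le_rfl x).trans (min_le_right _ _)).trans_lt hb
  have h3 := tendsto_riskAt hσ h0 hp hhp hf₀ hB hhB hlim z₀
  obtain ⟨j, hj⟩ := (h3.eventually (lt_mem_nhds ha)).exists
  filter_upwards [eventually_lt_riskAt hσ h0 h1 h2 hp (h j) hz hj, eventually_ge_atTop j]
    with k hk hjk
  exact hk.trans_le (riskAt_mono hσ h0 (hhp j) (hf k)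
    (fun x => (hhf j k hjk x).trans (min_le_left _ _)) _)

end Regularity

end ControlledModel

/-! ### Products of kernels -/

section KernelProducts

variable {Y : Type*} [MeasurableSpace Y]

/-- `kernelProd R n` applies the kernels `R 0, …, R n` one after the other. -/
def kernelProd (R : ℕ → Kernel Y Y) : ℕ → Kernel Y Y
  | 0 => R 0
  | n + 1 => R (n + 1) ∘ₖ kernelProd R n

/-- The sum of the first `n` products. -/
def kernelProdSum (R : ℕ → Kernel Y Y) : ℕ → Kernel Y Y
  | 0 => 0
  | n + 1 => kernelProdSum R n + kernelProd R n

theorem kernelProd_mem {R : ℕ → Kernel Y Y} {𝔐 : Y → Set (Measure Y)}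
    (hR : ∀ n, IsKernelSelector (R n) 𝔐) (n : ℕ) :
    IsKernelSelector (kernelProd R n) (multiPow 𝔐 n) := by
  induction n with
  | zero => exact hR 0
  | succ n ih => exact fun y => ⟨kernelProd R n, R (n + 1), ih, hR (n + 1), rfl⟩

theorem kernelProdSum_mem {R : ℕ → Kernel Y Y} {𝔐 : Y → Set (Measure Y)}
    (hR : ∀ n, IsKernelSelector (R n) 𝔐) (n : ℕ) :
    IsKernelSelector (kernelProdSum R n) (multiPowSum 𝔐 n) := by
  induction n with
  | zero => exact fun y => rfl
  | succ n ih => exact fun y => ⟨_, ih y, _, kernelProd_mem hR n y, rfl⟩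

/-- Unrolling the backward recursion `G (m + 1) = W + N m G m` of length `T` gives the integral of
`W` with respect to the sum of the products of the kernels in reverse order. -/
theorem backward_recursion_eq {N : ℕ → Kernel Y Y} {G : ℕ → Y → ℝ≥0∞} {W : Y → ℝ≥0∞}
    (hW : Measurable W) (hG : ∀ m, Measurable (G m)) (h0 : ∀ y, G 0 y = W y) {T : ℕ}
    (hrec : ∀ m < T, ∀ y, G (m + 1) y = W y + ∫⁻ x, G m x ∂N m y) (y : Y) :
    G T y = W y + ∫⁻ x, W x ∂kernelProdSum (fun j => N (T - 1 - j)) T y := by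
  set R : ℕ → Kernel Y Y := fun j => N (T - 1 - j) with hR
  rcases T.eq_zero_or_pos with rfl | hT
  · simp [kernelProdSum, h0]
  have key : ∀ k m, k + m + 1 = T → G T y = W y + ∫⁻ x, W x ∂kernelProdSum R k y +
      ∫⁻ x, G m x ∂kernelProd R k y := by
    intro k
    induction k with
    | zero =>
      intro m hm
      have e : T - 1 - 0 = m := by omega
      have e' : T = m + 1 := by omega
      simp only [kernelProdSum, kernelProd, hR, e, zero_apply, lintegral_zero_measure,
        add_zero]
      rw [e', hrec m (by omega)]
    | succ k ih =>
      intro m hm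
      rw [ih (m + 1) (by omega)]
      have e : R (k + 1) = N m := by simp only [hR]; congr 1; omega
      have h1 : ∫⁻ x, G (m + 1) x ∂kernelProd R k y =
          ∫⁻ x, W x ∂kernelProd R k y + ∫⁻ x, G m x ∂kernelProd R (k + 1) y := by
        rw [kernelProd, e, Kernel.lintegral_comp _ _ _ (hG m), ← lintegral_add_left hW]
        exact lintegral_congr fun x => hrec m (by omega) x
      rw [h1, kernelProdSum, add_apply, lintegral_add_measure]
      ring
  rw [key (T - 1) 0 (by omega)]
  obtain ⟨n, rfl⟩ : ∃ n, T = n + 1 := ⟨T - 1, by omega⟩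
  simp only [h0, Nat.add_sub_cancel, kernelProdSum, add_apply, lintegral_add_measure,
    add_assoc]

end KernelProducts

namespace ControlledModel

/-! ### Evaluation of stationary policies -/

/-- The weight function, replaced by zero at the absorbing state. -/
def effWeight {X A : Type*} [MeasurableSpace X] [TopologicalSpace A] [MeasurableSpace A]
    (M : ControlledModel X A) (w : X → ℝ) : X → ℝ :=
  Set.indicator {M.xA}ᶜ w

section EffWeight

variable {X A : Type*} [MeasurableSpace X] [TopologicalSpace A] [MeasurableSpace A]
  {M : ControlledModel X A} {w : X → ℝ}

theorem effWeight_xA : M.effWeight w M.xA = 0 := by simp [effWeight]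

theorem effWeight_of_ne {x : X} (hx : x ≠ M.xA) : M.effWeight w x = w x := by simp [effWeight, hx]

theorem effWeight_nonneg (hw : ∀ x, 1 ≤ w x) (x : X) : 0 ≤ M.effWeight w x :=
  Set.indicator_nonneg (fun x _ => zero_le_one.trans (hw x)) x

theorem effWeight_le (hw : ∀ x, 1 ≤ w x) (x : X) : M.effWeight w x ≤ w x :=
  Set.indicator_le_self' (fun x _ => zero_le_one.trans (hw x)) x

theorem measurable_effWeight [MeasurableSingletonClass X] (hw : Measurable w) :
    Measurable (M.effWeight w) :=
  hw.indicator (measurableSet_singleton _).compl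

theorem memLp_of_le_effWeight {p : ℝ≥0∞} {P0 : Measure X} (hw : ∀ x, 1 ≤ w x) (hwp : MemLp w p P0)
    {f : X → ℝ} (hf : AEStronglyMeasurable f P0) {a : ℝ} (hfa : ∀ x, |f x| ≤ a * M.effWeight w x) :
    MemLp f p P0 := by
  refine (hwp.const_mul |a|).mono' hf (Eventually.of_forall fun x => ?_)
  calc ‖f x‖ ≤ a * M.effWeight w x := hfa x
    _ ≤ |a| * M.effWeight w x := by gcongr; exacts [effWeight_nonneg hw x, le_abs_self a]
    _ ≤ |a| * w x := by gcongr; exact effWeight_le hw x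

theorem measurable_pair (π : M.DecisionRule) : Measurable π.pair :=
  (measurable_id.prodMk π.measurable).subtype_mk

end EffWeight

section Evaluation

set_option linter.unusedSectionVars false

variable {X A : Type*} [TopologicalSpace X] [TopologicalSpace.MetrizableSpace X]
  [SecondCountableTopology X] [MeasurableSpace X] [BorelSpace X] [StandardBorelSpace X]
  [TopologicalSpace A] [TopologicalSpace.MetrizableSpace A] [SecondCountableTopology A]
  [MeasurableSpace A] [BorelSpace A]
  {M : ControlledModel X A} {p : ℝ≥0∞} [Fact (1 ≤ p)] {P0 : Measure X} [IsProbabilityMeasure P0]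
  {σ : Lp ℝ p P0 → X → DualProb p P0 → ℝ} {w : X → ℝ}

/-- The nested risk of the accumulated weights over `n` transitions under a decision rule. -/
def weightIter (M : ControlledModel X A) (σ : Lp ℝ p P0 → X → DualProb p P0 → ℝ) (h0 : M.G0 p P0)
    (w : X → ℝ) (π : M.DecisionRule) : ℕ → X → ℝ
  | 0 => M.effWeight w
  | n + 1 => fun x => M.effWeight w x + M.riskAt σ h0 (weightIter M σ h0 w π n) (π.pair x)

variable (hσ : IsRiskTransition σ) (h0 : M.G0 p P0) (h1 : M.G1 p P0) (hp : p ≠ ∞)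
  (hwm : Measurable w) (hw1 : ∀ x, 1 ≤ w x) (hwp : MemLp w p P0)

include hσ h1 hp hwm hw1 hwp

/-- Risk transience bounds the accumulated weights: each one-step risk is attained at a kernel of
subgradients, and the products of these kernels are selectors of the powers of the effective
multikernel. -/
theorem weightIter_bound {K : ℝ≥0} {π : M.DecisionRule}
    (hK : ∀ (T : ℕ) (N : Kernel M.Eff M.Eff),
      IsKernelSelector N (multiPowSum (M.effMultikernel σ h0 π) T) →
        kernelWNorm (fun x : M.Eff => w x.1) N ≤ K) (n : ℕ) :
    Measurable (M.weightIter σ h0 w π n) ∧ (∀ x, 0 ≤ M.weightIter σ h0 w π n x) ∧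
      ∀ x, M.weightIter σ h0 w π n x ≤ (1 + K) * M.effWeight w x := by
  induction n using Nat.strong_induction_on with
  | _ T ih =>
  set g := M.weightIter σ h0 w π with hg
  rcases T.eq_zero_or_pos with rfl | hT
  · refine ⟨measurable_effWeight hwm, effWeight_nonneg hw1, fun x => ?_⟩
    have : 0 ≤ M.effWeight w x := effWeight_nonneg hw1 x
    change M.effWeight w x ≤ _
    nlinarith [K.coe_nonneg, mul_nonneg K.coe_nonneg this]
  have hmem : ∀ m < T, MemLp (g m) p P0 := fun m hm =>
    memLp_of_le_effWeight hw1 hwp (ih m hm).1.aestronglyMeasurable fun x => by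
      rw [abs_of_nonneg ((ih m hm).2.1 x)]
      exact (ih m hm).2.2 x
  have hxA : ∀ m < T, g m M.xA = 0 := fun m hm =>
    le_antisymm (by simpa [effWeight_xA] using (ih m hm).2.2 M.xA) ((ih m hm).2.1 _)
  have hmeas : ∀ m ≤ T, Measurable (g m) := by
    intro m hm
    cases m with
    | zero => exact measurable_effWeight hwm
    | succ m =>
      refine (measurable_effWeight hwm).add
        (measurable_riskAt hσ h0 h1 hp (F := fun _ => g m) ?_ (fun _ => hmem m hm)
          (measurable_pair π))
      exact (ih m hm).1.comp measurable_snd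
  have hnn : ∀ m ≤ T, ∀ x, 0 ≤ g m x := by
    intro m hm x
    cases m with
    | zero => exact effWeight_nonneg hw1 x
    | succ m =>
      exact add_nonneg (effWeight_nonneg hw1 x)
        (riskAt_nonneg hσ h0 (hmem m hm) (ih m hm).2.1 _)
  refine ⟨hmeas T le_rfl, hnn T le_rfl, fun x => ?_⟩
  obtain ⟨n, rfl⟩ : ∃ n, T = n + 1 := ⟨T - 1, by omega⟩
  rcases eq_or_ne x M.xA with rfl | hx
  · change M.effWeight w M.xA + M.riskAt σ h0 (g n) (π.pair M.xA) ≤ _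
    rw [riskAt_absorbing hσ h0 (hmem n n.lt_succ_self) _ rfl, hxA n n.lt_succ_self, effWeight_xA]
    simp
  -- The functions beyond the horizon play no role and are replaced by zero.
  let f : ℕ → X → ℝ := fun m => if m < n + 1 then g m else 0
  have hfp : ∀ m, MemLp (f m) p P0 := by
    intro m
    by_cases hm : m < n + 1
    · simpa only [f, hm, if_true] using hmem m hm
    · simp only [f, hm, if_false]
      exact MemLp.zero
  choose N hN using fun m => exists_kernel_riskMultikernel hσ h0 h1 hp π (hfp m)
  have hS : MeasurableSet {x : X | x ≠ M.xA} := (measurableSet_singleton M.xA).compl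
  let N' : ℕ → Kernel M.Eff M.Eff := fun m =>
    ((N m).comap Subtype.val measurable_subtype_coe).comapRight (MeasurableEmbedding.subtype_coe hS)
  have hN' : ∀ m y, N' m y = (N m y.1).comap Subtype.val := fun m y => rfl
  have hsel : ∀ m, IsKernelSelector (N' m) (M.effMultikernel σ h0 π) := fun m y =>
    ⟨N m y.1, (hN m y.1).1, (hN' m y).symm⟩
  let G : ℕ → M.Eff → ℝ≥0∞ := fun m y => if m ≤ n + 1 then ENNReal.ofReal (g m y.1) else 0
  let W : M.Eff → ℝ≥0∞ := fun y => ENNReal.ofReal (w y.1)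
  have hWm : Measurable W := (hwm.comp measurable_subtype_coe).ennreal_ofReal
  have hGm : ∀ m, Measurable (G m) := by
    intro m
    by_cases hm : m ≤ n + 1
    · simp only [G, hm, if_true]
      exact ((hmeas m hm).comp measurable_subtype_coe).ennreal_ofReal
    · simp only [G, hm, if_false]
      exact measurable_const
  have hG0 : ∀ y, G 0 y = W y := by
    intro y
    simp only [G, W, Nat.zero_le, if_true]
    exact congrArg _ (effWeight_of_ne y.2)
  have hrec : ∀ m < n + 1, ∀ y, G (m + 1) y = W y + ∫⁻ x, G m x ∂N' m y := by
    intro m hm y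
    have hm' : m + 1 ≤ n + 1 := hm
    have hint : ∫⁻ x, G m x ∂N' m y = ENNReal.ofReal (M.riskAt σ h0 (g m) (π.pair y.1)) := by
      obtain ⟨-, hi, he⟩ := hN m y.1
      simp only [f, hm, if_true] at hi he
      rw [← he, ofReal_integral_eq_lintegral_ofReal hi (Eventually.of_forall (ih m hm).2.1), hN']
      simp only [G, hm.le, if_true]
      have h3 := lintegral_subtype_comap (μ := N m y.1) hS fun x => ENNReal.ofReal (g m x)
      refine h3.trans ?_
      rw [← lintegral_indicator hS]
      refine lintegral_congr fun x => ?_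
      by_cases hx : x = M.xA
      · subst hx
        simp [hxA m hm]
      · rw [Set.indicator_of_mem (show x ∈ {x | x ≠ M.xA} from hx)]
    rw [hint]
    simp only [G, W, hm', if_true]
    rw [← ENNReal.ofReal_add (zero_le_one.trans (hw1 _))
      (riskAt_nonneg hσ h0 (hmem m hm) (ih m hm).2.1 _)]
    congr 1
    change M.effWeight w y.1 + _ = _
    rw [effWeight_of_ne y.2]
  have hunroll := backward_recursion_eq hWm hGm hG0 hrec ⟨x, hx⟩
  have hb := hK (n + 1) _ (kernelProdSum_mem (R := fun j => N' (n + 1 - 1 - j))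
    (fun j => hsel _) (n + 1))
  have hb' := (le_iSup (fun y : M.Eff => (∫⁻ y', ENNReal.ofReal (w y'.1)
    ∂kernelProdSum (fun j => N' (n + 1 - 1 - j)) (n + 1) y) / ENNReal.ofReal (w y.1))
    ⟨x, hx⟩).trans hb
  have hwpos : 0 < w x := zero_lt_one.trans_le (hw1 x)
  rw [ENNReal.div_le_iff (ENNReal.ofReal_pos.2 hwpos).ne' ENNReal.ofReal_ne_top] at hb'
  have hle : G (n + 1) ⟨x, hx⟩ ≤ ENNReal.ofReal ((1 + K) * w x) := by
    rw [hunroll]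
    refine (add_le_add_right hb' _).trans_eq ?_
    rw [add_mul, one_mul, ENNReal.ofReal_add hwpos.le (by positivity),
      ENNReal.ofReal_mul K.coe_nonneg, ENNReal.ofReal_coe_nnreal]
  simp only [G, le_refl, if_true] at hle
  rw [effWeight_of_ne hx]
  exact (ENNReal.ofReal_le_ofReal_iff (by positivity)).1 hle

/-- The accumulated weights of a decision rule solve the evaluation equation and are comparable to
the weight function. -/
structure IsEvaluation (M : ControlledModel X A) (σ : Lp ℝ p P0 → X → DualProb p P0 → ℝ)
    (h0 : M.G0 p P0) (w : X → ℝ) (K : ℝ≥0) (π : M.DecisionRule) (W : X → ℝ) : Prop where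
  measurable : Measurable W
  lower : ∀ x, M.effWeight w x ≤ W x
  upper : ∀ x, W x ≤ (1 + K) * M.effWeight w x
  eq : ∀ x, W x = M.effWeight w x + M.riskAt σ h0 W (π.pair x)

theorem exists_isEvaluation {K : ℝ≥0} (π : M.DecisionRule)
    (hK : ∀ (T : ℕ) (N : Kernel M.Eff M.Eff),
      IsKernelSelector N (multiPowSum (M.effMultikernel σ h0 π) T) →
        kernelWNorm (fun x : M.Eff => w x.1) N ≤ K) :
    ∃ W, IsEvaluation M σ h0 w K π W := by
  set g := M.weightIter σ h0 w π with hg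
  have hb := weightIter_bound hσ h0 h1 hp hwm hw1 hwp hK
  have habs : ∀ n x, |g n x| ≤ (1 + K) * M.effWeight w x := fun n x => by
    rw [abs_of_nonneg ((hb n).2.1 x)]
    exact (hb n).2.2 x
  have hmem : ∀ n, MemLp (g n) p P0 := fun n =>
    memLp_of_le_effWeight hw1 hwp (hb n).1.aestronglyMeasurable (habs n)
  have hmono : ∀ n x, g n x ≤ g (n + 1) x := by
    intro n
    induction n with
    | zero => exact fun x => le_add_of_nonneg_right (riskAt_nonneg hσ h0 (hmem 0) (hb 0).2.1 _)
    | succ n ih => exact fun x =>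
        add_le_add_right (riskAt_mono hσ h0 (hmem n) (hmem (n + 1)) ih _) _
  have hbdd : ∀ x, BddAbove (Set.range fun n => g n x) := fun x =>
    ⟨(1 + K) * M.effWeight w x, by rintro _ ⟨n, rfl⟩; exact (hb n).2.2 x⟩
  let W : X → ℝ := fun x => ⨆ n, g n x
  have hlim : ∀ x, Tendsto (fun n => g n x) atTop (𝓝 (W x)) := fun x =>
    tendsto_atTop_ciSup (monotone_nat_of_le_succ fun n => hmono n x) (hbdd x)
  have hWm : Measurable W :=
    measurable_of_tendsto_metrizable (fun n => (hb n).1) (tendsto_pi_nhds.2 hlim)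
  have hlow : ∀ x, M.effWeight w x ≤ W x := fun x => le_ciSup (hbdd x) 0
  have hupp : ∀ x, W x ≤ (1 + K) * M.effWeight w x := fun x => ciSup_le fun n => (hb n).2.2 x
  have hWp : MemLp W p P0 := memLp_of_le_effWeight hw1 hwp hWm.aestronglyMeasurable
    fun x => by
      rw [abs_of_nonneg ((effWeight_nonneg hw1 x).trans (hlow x))]
      exact hupp x
  refine ⟨W, hWm, hlow, hupp, fun x => ?_⟩
  have hBp : MemLp (fun x => (1 + K : ℝ) * M.effWeight w x) p P0 :=
    memLp_of_le_effWeight hw1 hwp ((measurable_effWeight hwm).const_mul _).aestronglyMeasurable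
      (a := 1 + K) fun x => by
        rw [abs_of_nonneg (mul_nonneg (by positivity) (effWeight_nonneg hw1 x))]
  have h3 := (tendsto_riskAt hσ h0 hp hmem hWp hBp habs hlim (π.pair x)).const_add
    (M.effWeight w x)
  exact tendsto_nhds_unique ((tendsto_add_atTop_iff_nat 1).2 (hlim x)) h3

end Evaluation

/-! ### Policy improvement and a uniform contraction -/

section Improvement

set_option linter.unusedSectionVars false

variable {X A : Type*} [TopologicalSpace X] [TopologicalSpace.MetrizableSpace X]
  [SecondCountableTopology X] [MeasurableSpace X] [BorelSpace X] [StandardBorelSpace X]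
  [TopologicalSpace A] [TopologicalSpace.MetrizableSpace A] [SecondCountableTopology A]
  [MeasurableSpace A] [BorelSpace A]
  {M : ControlledModel X A} {p : ℝ≥0∞} [Fact (1 ≤ p)] {P0 : Measure X} [IsProbabilityMeasure P0]
  {σ : Lp ℝ p P0 → X → DualProb p P0 → ℝ} {w : X → ℝ}

/-- If the risk of `W` is at most `θ W` along a decision rule with `θ < 1`, then a function that is
dominated both by a multiple of `W` and by its own risk is nonpositive. -/
theorem nonpos_of_le_riskAt (hσ : IsRiskTransition σ) (h0 : M.G0 p P0) {π : M.DecisionRule}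
    {W d : X → ℝ} (hW : MemLp W p P0) (hd : MemLp d p P0) {θ a : ℝ} (hθ0 : 0 ≤ θ) (hθ1 : θ < 1)
    (ha : 0 ≤ a) (hcontr : ∀ x, M.riskAt σ h0 W (π.pair x) ≤ θ * W x) (hdW : ∀ x, d x ≤ a * W x)
    (hdd : ∀ x, d x ≤ M.riskAt σ h0 d (π.pair x)) (x : X) : d x ≤ 0 := by
  have key : ∀ n : ℕ, ∀ x, d x ≤ a * θ ^ n * W x := by
    intro n
    induction n with
    | zero => simpa using hdW
    | succ n ih =>
      intro x
      have h1 := riskAt_le_add_mul hσ h0 hd (memLp_const 0) hW (a := a * θ ^ n) (by positivity)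
        (fun y => by simpa using ih y) (π.pair x)
      rw [riskAt_const hσ h0, zero_add] at h1
      calc d x ≤ a * θ ^ n * M.riskAt σ h0 W (π.pair x) := (hdd x).trans h1
        _ ≤ a * θ ^ n * (θ * W x) := by gcongr; exact hcontr x
        _ = _ := by ring
  have hlim : Tendsto (fun n : ℕ => a * θ ^ n * W x) atTop (𝓝 0) := by
    simpa using ((tendsto_pow_atTop_nhds_zero_of_lt_one hθ0 hθ1).const_mul a).mul_const (W x)
  exact ge_of_tendsto' hlim fun n => key n x

/-- The contraction factor for the weights that are comparable to the weight function within the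
factor `1 + K`. -/
theorem sub_le_mul_of_le {K : ℝ≥0} {W e : ℝ} (hup : W ≤ (1 + K) * e) :
    W - e ≤ (K / (1 + K) : ℝ) * W := by
  have hK : (0 : ℝ) < 1 + K := by positivity
  have h1 : W / (1 + K) ≤ e := (div_le_iff₀ hK).2 (by linarith)
  have h2 : (K / (1 + K) : ℝ) * W = W - W / (1 + K) := by field_simp; ring
  linarith

theorem IsEvaluation.memLp {h0 : M.G0 p P0} {K : ℝ≥0} {π : M.DecisionRule} {W : X → ℝ}
    (hE : IsEvaluation M σ h0 w K π W) (hw1 : ∀ x, 1 ≤ w x) (hwp : MemLp w p P0) :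
    MemLp W p P0 :=
  memLp_of_le_effWeight hw1 hwp hE.measurable.aestronglyMeasurable fun x => by
    rw [abs_of_nonneg ((effWeight_nonneg hw1 x).trans (hE.lower x))]
    exact hE.upper x

/-- A weight function that is contracted by the one-step risk under all controls simultaneously. -/
structure IsContractiveWeight (M : ControlledModel X A) (σ : Lp ℝ p P0 → X → DualProb p P0 → ℝ)
    (h0 : M.G0 p P0) (w : X → ℝ) (θ : ℝ) (W : X → ℝ) : Prop where
  nonneg_factor : 0 ≤ θ
  factor_lt_one : θ < 1
  measurable : Measurable W
  memLp : MemLp W p P0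
  lower : ∀ x, M.effWeight w x ≤ W x
  bounded : ∃ C : ℝ, 0 ≤ C ∧ ∀ x, W x ≤ C * M.effWeight w x
  contract : ∀ z : M.Graph, M.riskAt σ h0 W z ≤ θ * W z.1.1

variable (hσ : IsRiskTransition σ) (h0 : M.G0 p P0) (h1 : M.G1 p P0) (hp : p ≠ ∞)
  (hwm : Measurable w) (hw1 : ∀ x, 1 ≤ w x) (hwp : MemLp w p P0) {K : ℝ≥0}
  (hK : ∀ (π : M.DecisionRule) (T : ℕ) (N : Kernel M.Eff M.Eff),
      IsKernelSelector N (multiPowSum (M.effMultikernel σ h0 π) T) →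
        kernelWNorm (fun x : M.Eff => w x.1) N ≤ K)

include hσ h1 hp hwm hw1 hwp hK

/-- Policy improvement: switching to the rule `u` in the states where this increases the accumulated
weight over one step gives a rule with larger accumulated weights. -/
theorem exists_improvement {π₀ : M.DecisionRule} {W₀ : X → ℝ}
    (hE : IsEvaluation M σ h0 w K π₀ W₀) (u : M.DecisionRule) :
    ∃ (π₁ : M.DecisionRule) (W₁ : X → ℝ), IsEvaluation M σ h0 w K π₁ W₁ ∧ (∀ x, W₀ x ≤ W₁ x) ∧
      ∀ x, M.effWeight w x + M.riskAt σ h0 W₀ (u.pair x) ≤ W₁ x := by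
  classical
  have hW₀ := hE.memLp hw1 hwp
  let B : Set X := {x | W₀ x < M.effWeight w x + M.riskAt σ h0 W₀ (u.pair x)}
  have hB : MeasurableSet B := by
    refine measurableSet_lt hE.measurable ((measurable_effWeight hwm).add ?_)
    exact measurable_riskAt hσ h0 h1 hp (F := fun _ => W₀) (hE.measurable.comp measurable_snd)
      (fun _ => hW₀) (measurable_pair u)
  let π₁ : M.DecisionRule :=
    { toFun := B.piecewise u.toFun π₀.toFun
      measurable := u.measurable.piecewise hB π₀.measurable
      feasible := fun x => by
        by_cases hx : x ∈ B
        · rw [Set.piecewise_eq_of_mem _ _ _ hx]; exact u.feasible x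
        · rw [Set.piecewise_eq_of_notMem _ _ _ hx]; exact π₀.feasible x }
  have hpair : ∀ x, (x ∈ B ∧ π₁.pair x = u.pair x) ∨ (x ∉ B ∧ π₁.pair x = π₀.pair x) := by
    intro x
    by_cases hx : x ∈ B
    · refine Or.inl ⟨hx, Subtype.ext (Prod.ext rfl ?_)⟩
      exact Set.piecewise_eq_of_mem _ _ _ hx
    · refine Or.inr ⟨hx, Subtype.ext (Prod.ext rfl ?_)⟩
      exact Set.piecewise_eq_of_notMem _ _ _ hx
  have hstep : ∀ x, W₀ x ≤ M.effWeight w x + M.riskAt σ h0 W₀ (π₁.pair x) ∧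
      M.effWeight w x + M.riskAt σ h0 W₀ (u.pair x) ≤
        M.effWeight w x + M.riskAt σ h0 W₀ (π₁.pair x) := by
    intro x
    rcases hpair x with ⟨hx, h⟩ | ⟨hx, h⟩
    · rw [h]
      exact ⟨le_of_lt hx, le_rfl⟩
    · rw [h, ← hE.eq x]
      exact ⟨le_rfl, not_lt.1 hx⟩
  obtain ⟨W₁, hE₁⟩ := exists_isEvaluation hσ h0 h1 hp hwm hw1 hwp π₁ (hK π₁)
  have hW₁ := hE₁.memLp hw1 hwp
  have hd : MemLp (fun x => W₀ x - W₁ x) p P0 := hW₀.sub hW₁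
  have hle : ∀ x, W₀ x - W₁ x ≤ 0 := by
    refine nonpos_of_le_riskAt hσ h0 (π := π₁) (θ := (K / (1 + K) : ℝ)) (a := 1 + K) hW₁ hd
      (by positivity) ?_ (by positivity) (fun x => ?_) (fun x => ?_) (fun x => ?_)
    · exact (div_lt_one (by positivity)).2 (by linarith)
    · have h3 := sub_le_mul_of_le (hE₁.upper x)
      linarith [hE₁.eq x]
    · have h3 := (effWeight_nonneg (M := M) hw1 x).trans (hE₁.lower x)
      have h4 : (1 + K : ℝ) * M.effWeight w x ≤ (1 + K) * W₁ x := by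
        gcongr
        exact hE₁.lower x
      linarith [hE.upper x]
    · have h3 := riskAt_add_le hσ h0 hd hW₁ (π₁.pair x)
      simp only [sub_add_cancel] at h3
      linarith [(hstep x).1, hE₁.eq x]
  have hle' : ∀ x, W₀ x ≤ W₁ x := fun x => sub_nonpos.1 (hle x)
  refine ⟨π₁, W₁, hE₁, hle', fun x => (hstep x).2.trans ?_⟩
  rw [hE₁.eq x]
  exact add_le_add_right (riskAt_mono hσ h0 hW₀ hW₁ hle' _) _

/-- Improving a decision rule by the rules of a dense family, each of them infinitely often,
increases the accumulated weights to a limit that no control can improve.  Thus transience of the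
stationary policies extends to all policies. -/
theorem exists_isContractiveWeight (h2 : G2 σ) (h4 : M.G4) :
    ∃ θ W, IsContractiveWeight M σ h0 w θ W := by
  obtain ⟨u, hu⟩ := M.exists_dense_decisionRules h4
  obtain ⟨W₀, hW₀⟩ := exists_isEvaluation hσ h0 h1 hp hwm hw1 hwp (u 0) (hK (u 0))
  choose f F hE hmono himp using
    fun (q : {q : M.DecisionRule × (X → ℝ) // IsEvaluation M σ h0 w K q.1 q.2}) =>
      exists_improvement hσ h0 h1 hp hwm hw1 hwp hK q.2
  let S : ℕ → {q : M.DecisionRule × (X → ℝ) // IsEvaluation M σ h0 w K q.1 q.2} := fun n =>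
    Nat.rec ⟨(u 0, W₀), hW₀⟩ (fun n q => ⟨(f q (u n.unpair.1), F q (u n.unpair.1)), hE q _⟩) n
  let V : ℕ → X → ℝ := fun n => (S n).1.2
  have hV : ∀ n, IsEvaluation M σ h0 w K (S n).1.1 (V n) := fun n => (S n).2
  have hVmono : ∀ n x, V n x ≤ V (n + 1) x := fun n x => hmono (S n) (u n.unpair.1) x
  have hVimp : ∀ n x, M.effWeight w x + M.riskAt σ h0 (V n) ((u n.unpair.1).pair x) ≤
      V (n + 1) x := fun n x => himp (S n) (u n.unpair.1) x
  have hVp : ∀ n, MemLp (V n) p P0 := fun n => (hV n).memLp hw1 hwp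
  have hbdd : ∀ x, BddAbove (Set.range fun n => V n x) := fun x =>
    ⟨(1 + K) * M.effWeight w x, by rintro _ ⟨n, rfl⟩; exact (hV n).upper x⟩
  let W : X → ℝ := fun x => ⨆ n, V n x
  have hVW : ∀ n x, V n x ≤ W x := fun n x => le_ciSup (hbdd x) n
  have hlim : ∀ x, Tendsto (fun n => V n x) atTop (𝓝 (W x)) := fun x =>
    tendsto_atTop_ciSup (monotone_nat_of_le_succ fun n => hVmono n x) (hbdd x)
  have hWm : Measurable W :=
    measurable_of_tendsto_metrizable (fun n => (hV n).measurable) (tendsto_pi_nhds.2 hlim)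
  have hlow : ∀ x, M.effWeight w x ≤ W x := fun x => ((hV 0).lower x).trans (hVW 0 x)
  have hupp : ∀ x, W x ≤ (1 + K) * M.effWeight w x := fun x => ciSup_le fun n => (hV n).upper x
  have hnn : ∀ x, 0 ≤ W x := fun x => (effWeight_nonneg hw1 x).trans (hlow x)
  have hWp : MemLp W p P0 := memLp_of_le_effWeight hw1 hwp hWm.aestronglyMeasurable
    fun x => by
      rw [abs_of_nonneg (hnn x)]
      exact hupp x
  have hVB : ∀ n x, |V n x| ≤ W x := fun n x => by
    rw [abs_of_nonneg ((effWeight_nonneg hw1 x).trans ((hV n).lower x))]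
    exact hVW n x
  -- The limit cannot be improved by any rule of the dense family.
  have hdense : ∀ i x, M.effWeight w x + M.riskAt σ h0 W ((u i).pair x) ≤ W x := by
    intro i x
    have h3 := tendsto_riskAt hσ h0 hp hVp hWp hWp hVB hlim ((u i).pair x)
    have hsub : Tendsto (fun k => Nat.pair i k) atTop atTop :=
      tendsto_atTop_mono (fun k => Nat.right_le_pair i k) tendsto_id
    refine le_of_tendsto' ((h3.comp hsub).const_add (M.effWeight w x)) fun k => ?_
    have h4 := hVimp (Nat.pair i k) x
    rw [Nat.unpair_pair] at h4
    exact h4.trans (hVW (Nat.pair i k + 1) x)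
  -- By density and lower semicontinuity it cannot be improved by any control.
  have hall : ∀ z : M.Graph, M.effWeight w z.1.1 + M.riskAt σ h0 W z ≤ W z.1.1 := by
    rintro ⟨⟨x, a⟩, ha⟩
    by_contra! hlt
    obtain ⟨b, hb, hba⟩ := mem_closure_iff_seq_limit.1 (hu x a ha)
    choose i hi using hb
    have hz : Tendsto (fun k => (u (i k)).pair x) atTop (𝓝 (⟨(x, a), ha⟩ : M.Graph)) := by
      refine tendsto_subtype_rng.2 (Tendsto.prodMk_nhds tendsto_const_nhds ?_)
      exact hba.congr fun k => (hi k).symm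
    have hlt' : W x - M.effWeight w x < M.riskAt σ h0 W ⟨(x, a), ha⟩ := by
      have : W x < M.effWeight w x + M.riskAt σ h0 W ⟨(x, a), ha⟩ := hlt
      linarith
    obtain ⟨k, hk⟩ := (eventually_lt_riskAt hσ h0 h1 h2 hp W hz hlt').exists
    linarith [hdense (i k) x]
  refine ⟨(K / (1 + K) : ℝ), W, by positivity, (div_lt_one (by positivity)).2 (by linarith), hWm,
    hWp, hlow, ⟨1 + K, by positivity, hupp⟩, fun z => ?_⟩
  have h3 := sub_le_mul_of_le (hupp z.1.1)
  linarith [hall z]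

end Improvement

/-! ### The dynamic programming operator -/

section Bellman

set_option linter.unusedSectionVars false

variable {X A : Type*} [TopologicalSpace X] [TopologicalSpace.MetrizableSpace X]
  [SecondCountableTopology X] [MeasurableSpace X] [BorelSpace X] [StandardBorelSpace X]
  [TopologicalSpace A] [TopologicalSpace.MetrizableSpace A] [SecondCountableTopology A]
  [MeasurableSpace A] [BorelSpace A]
  {M : ControlledModel X A} {p : ℝ≥0∞} [Fact (1 ≤ p)] {P0 : Measure X} [IsProbabilityMeasure P0]
  {σ : Lp ℝ p P0 → X → DualProb p P0 → ℝ} {w : X → ℝ}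

theorem G3.measurable_section (h3 : M.G3 w) (x : X) (u : A) : Measurable (M.c x u) :=
  h3.measurable.comp (measurable_const.prodMk (measurable_const.prodMk measurable_id))

theorem G3.measurable_pair (h3 : M.G3 w) {H : Type*} [MeasurableSpace H] {ζ : H → M.Graph}
    (hζ : Measurable ζ) : Measurable fun q : H × X => M.c (ζ q.1).1.1 (ζ q.1).1.2 q.2 := by
  have h : Measurable fun q : H × X => (ζ q.1).1 :=
    measurable_subtype_coe.comp (hζ.comp measurable_fst)
  exact h3.measurable.comp
    ((measurable_fst.comp h).prodMk ((measurable_snd.comp h).prodMk measurable_snd))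

theorem G3.memLp (h3 : M.G3 w) (hwp : MemLp w p P0) (z : M.Graph) :
    MemLp (M.c z.1.1 z.1.2) p P0 := by
  obtain ⟨C, hC⟩ := h3.bounded
  exact (((memLp_const (w z.1.1)).add hwp).const_mul C).mono'
    (h3.measurable_section _ _).aestronglyMeasurable
    (Eventually.of_forall fun y => hC _ _ z.2 y)

theorem riskAt_abs_le (hσ : IsRiskTransition σ) (h0 : M.G0 p P0) {f g : X → ℝ}
    (hf : MemLp f p P0) (hg : MemLp g p P0) (hfg : ∀ y, |f y| ≤ g y) (z : M.Graph) :
    |M.riskAt σ h0 f z| ≤ M.riskAt σ h0 g z := by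
  have h1 := riskAt_mono hσ h0 hf hg (fun y => le_of_abs_le (hfg y)) z
  have h2 := riskAt_mono hσ h0 hf.neg hg (fun y => (neg_le_abs _).trans (hfg y)) z
  have h3 := riskAt_add_le hσ h0 hf hf.neg z
  simp only [Pi.neg_apply, add_neg_cancel] at h3
  rw [riskAt_const hσ h0] at h3
  exact abs_le.2 ⟨by linarith, h1⟩

/-- Functions bounded by a multiple of `W`. -/
def BoundedBy (W v : X → ℝ) : Prop := ∃ a : ℝ, 0 ≤ a ∧ ∀ x, |v x| ≤ a * W x

theorem IsContractiveWeight.nonneg {h0 : M.G0 p P0} {θ : ℝ} {W : X → ℝ}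
    (hW : IsContractiveWeight M σ h0 w θ W) (hw1 : ∀ x, 1 ≤ w x) (x : X) : 0 ≤ W x :=
  (effWeight_nonneg hw1 x).trans (hW.lower x)

theorem IsContractiveWeight.apply_xA {h0 : M.G0 p P0} {θ : ℝ} {W : X → ℝ}
    (hW : IsContractiveWeight M σ h0 w θ W) (hw1 : ∀ x, 1 ≤ w x) : W M.xA = 0 := by
  obtain ⟨C, -, hC⟩ := hW.bounded
  exact le_antisymm (by simpa [effWeight_xA] using hC M.xA) (hW.nonneg hw1 _)

theorem BoundedBy.memLp {W v : X → ℝ} (hv : BoundedBy W v) (hvm : Measurable v)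
    (hWp : MemLp W p P0) : MemLp v p P0 := by
  obtain ⟨a, -, h⟩ := hv
  exact (hWp.const_mul a).mono' hvm.aestronglyMeasurable (Eventually.of_forall h)

theorem boundedBy_of_wBounded {h0 : M.G0 p P0} {θ : ℝ} {W v : X → ℝ}
    (hW : IsContractiveWeight M σ h0 w θ W) (hw1 : ∀ x, 1 ≤ w x) (hv : WBounded w v)
    (hvA : v M.xA = 0) : BoundedBy W v := by
  obtain ⟨C, hC⟩ := hv
  refine ⟨|C|, abs_nonneg C, fun x => ?_⟩
  rcases eq_or_ne x M.xA with rfl | hx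
  · rw [hvA, hW.apply_xA hw1]
    simp
  · calc |v x| ≤ C * w x := hC x
      _ ≤ |C| * w x := by gcongr; exacts [zero_le_one.trans (hw1 x), le_abs_self C]
      _ = |C| * M.effWeight w x := by rw [effWeight_of_ne hx]
      _ ≤ |C| * W x := by gcongr; exact hW.lower x

theorem BoundedBy.wBounded {h0 : M.G0 p P0} {θ : ℝ} {W v : X → ℝ} (hv : BoundedBy W v)
    (hW : IsContractiveWeight M σ h0 w θ W) (hw1 : ∀ x, 1 ≤ w x) : WBounded w v := by
  obtain ⟨a, ha, h⟩ := hv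
  obtain ⟨C, hC0, hC⟩ := hW.bounded
  refine ⟨a * C, fun x => ?_⟩
  calc |v x| ≤ a * W x := h x
    _ ≤ a * (C * w x) := by
      gcongr
      exact (hC x).trans (by gcongr; exact effWeight_le hw1 x)
    _ = a * C * w x := by ring

theorem BoundedBy.apply_xA {h0 : M.G0 p P0} {θ : ℝ} {W v : X → ℝ} (hv : BoundedBy W v)
    (hW : IsContractiveWeight M σ h0 w θ W) (hw1 : ∀ x, 1 ≤ w x) : v M.xA = 0 := by
  obtain ⟨a, -, h⟩ := hv
  have := h M.xA
  rw [hW.apply_xA hw1, mul_zero] at this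
  exact abs_nonpos_iff.1 this

variable (hσ : IsRiskTransition σ) (h0 : M.G0 p P0) (hw1 : ∀ x, 1 ≤ w x) (hwp : MemLp w p P0)
  (h3 : M.G3 w) {θ : ℝ} {W : X → ℝ} (hW : IsContractiveWeight M σ h0 w θ W)

include hσ hw1 hwp h3 hW

/-- The risk of the absolute one-step cost is bounded by a multiple of the contractive weight. -/
theorem exists_riskAt_abs_cost_le : ∃ C₀ : ℝ, 0 ≤ C₀ ∧ ∀ z : M.Graph,
    M.riskAt σ h0 (fun y => |M.c z.1.1 z.1.2 y|) z ≤ C₀ * W z.1.1 := by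
  obtain ⟨C, hC⟩ := h3.bounded
  have hwA : 0 ≤ w M.xA := zero_le_one.trans (hw1 _)
  refine ⟨|C| * (2 + w M.xA), by positivity, fun z => ?_⟩
  have hcp : MemLp (fun y => |M.c z.1.1 z.1.2 y|) p P0 := (h3.memLp hwp z).abs
  rcases eq_or_ne z.1.1 M.xA with hz | hz
  · have hc : M.c z.1.1 z.1.2 M.xA = 0 := by
      obtain ⟨⟨x, u⟩, hu⟩ := z
      obtain rfl : x = M.xA := hz
      exact M.cost_absorbing u hu
    rw [riskAt_absorbing hσ h0 hcp z hz, hc, hz, hW.apply_xA hw1]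
    simp
  · set b : ℝ := w z.1.1 + w M.xA with hb
    have hle : ∀ y, |M.c z.1.1 z.1.2 y| ≤ |C| * b + |C| * W y := by
      intro y
      have h4 : w y ≤ w M.xA + W y := by
        rcases eq_or_ne y M.xA with rfl | hy
        · linarith [hW.nonneg hw1 M.xA]
        · have := hW.lower y
          rw [effWeight_of_ne hy] at this
          linarith
      have h5 : 0 ≤ w z.1.1 + w y :=
        add_nonneg (zero_le_one.trans (hw1 _)) (zero_le_one.trans (hw1 _))
      calc |M.c z.1.1 z.1.2 y| ≤ C * (w z.1.1 + w y) := hC _ _ z.2 y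
        _ ≤ |C| * (w z.1.1 + w y) := by gcongr; exact le_abs_self C
        _ ≤ |C| * (w z.1.1 + (w M.xA + W y)) := by gcongr
        _ = _ := by rw [hb]; ring
    have h6 := riskAt_le_add_mul hσ h0 hcp (memLp_const (|C| * b)) hW.memLp (abs_nonneg C) hle z
    rw [riskAt_const hσ h0] at h6
    have h7 := hW.contract z
    have h8 : w z.1.1 ≤ W z.1.1 := by
      have := hW.lower z.1.1
      rwa [effWeight_of_ne hz] at this
    have h9 : w M.xA ≤ w M.xA * W z.1.1 := by nlinarith [hw1 z.1.1]
    have h10 : θ * W z.1.1 ≤ W z.1.1 := by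
      nlinarith [hW.factor_lt_one, hW.nonneg hw1 z.1.1]
    calc _ ≤ |C| * b + |C| * M.riskAt σ h0 W z := h6
      _ ≤ |C| * (W z.1.1 + w M.xA * W z.1.1) + |C| * W z.1.1 := by
        gcongr
        · linarith
        · linarith
      _ = _ := by ring

/-- The one-step risk of the cost and a further term. -/
theorem exists_riskAt_cost_add_le : ∃ C₀ : ℝ, 0 ≤ C₀ ∧ ∀ (z : M.Graph) (f : X → ℝ) (a : ℝ),
    0 ≤ a → Measurable f → (∀ y, |f y| ≤ a * W y) →
      |M.riskAt σ h0 (fun y => M.c z.1.1 z.1.2 y + f y) z| ≤ (C₀ + a * θ) * W z.1.1 := by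
  obtain ⟨C₀, hC0, hC⟩ := exists_riskAt_abs_cost_le hσ h0 hw1 hwp h3 hW
  refine ⟨C₀, hC0, fun z f a ha hfm hfa => ?_⟩
  have hf : MemLp f p P0 := BoundedBy.memLp ⟨a, ha, hfa⟩ hfm hW.memLp
  have hc := h3.memLp hwp z
  have hca : MemLp (fun y => |M.c z.1.1 z.1.2 y|) p P0 := hc.abs
  refine (riskAt_abs_le hσ h0 (hc.add hf) (hca.add (hW.memLp.const_mul a)) (fun y => ?_) z).trans ?_
  · exact (abs_add_le _ _).trans (add_le_add_right (hfa y) _)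
  · refine (riskAt_le_add_mul hσ h0 (hca.add (hW.memLp.const_mul a)) hca hW.memLp ha
      (fun y => le_rfl) z).trans ?_
    have := mul_le_mul_of_nonneg_left (hW.contract z) ha
    linarith [hC z]

/-- The dynamic programming operator contracts differences measured by the contractive weight. -/
theorem riskAt_cost_add_le {f g : X → ℝ} (hf : MemLp f p P0) (hg : MemLp g p P0) {a : ℝ}
    (ha : 0 ≤ a) (h : ∀ y, f y ≤ g y + a * W y) (z : M.Graph) :
    M.riskAt σ h0 (fun y => M.c z.1.1 z.1.2 y + f y) z ≤
      M.riskAt σ h0 (fun y => M.c z.1.1 z.1.2 y + g y) z + a * θ * W z.1.1 := by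
  have hc := h3.memLp hwp z
  refine (riskAt_le_add_mul hσ h0 (hc.add hf) (hc.add hg) hW.memLp ha (fun y => ?_) z).trans ?_
  · change M.c z.1.1 z.1.2 y + f y ≤ M.c z.1.1 z.1.2 y + g y + a * W y
    linarith [h y]
  · have := mul_le_mul_of_nonneg_left (hW.contract z) ha
    rw [mul_assoc]
    exact add_le_add_right this _

omit hW in
/-- Lower semicontinuity in the state and the control, on the sets where the weight is bounded. -/
theorem eventually_lt_bellman (h1 : M.G1 p P0) (h2 : G2 σ) (hp : p ≠ ∞) {v : X → ℝ}
    (hvm : Measurable v) (hv : MemLp v p P0) {n : ℝ} {z : ℕ → M.Graph} {z₀ : M.Graph}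
    (hz : Tendsto z atTop (𝓝 z₀)) (hwz : ∀ k, w (z k).1.1 ≤ n) (hwz₀ : w z₀.1.1 ≤ n) {a : ℝ}
    (ha : a < M.bellman σ h0 v z₀) : ∀ᶠ k in atTop, a < M.bellman σ h0 v (z k) := by
  obtain ⟨C, hC⟩ := h3.bounded
  have hb : ∀ z : M.Graph, w z.1.1 ≤ n → ∀ y, |M.c z.1.1 z.1.2 y + v y| ≤
      |C| * (n + w y) + |v y| := by
    intro z hz y
    have hwy : 0 ≤ w y := zero_le_one.trans (hw1 y)
    have hwz : 0 ≤ w z.1.1 := zero_le_one.trans (hw1 _)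
    refine (abs_add_le _ _).trans (add_le_add_left ?_ _)
    calc |M.c z.1.1 z.1.2 y| ≤ C * (w z.1.1 + w y) := hC _ _ z.2 y
      _ ≤ |C| * (w z.1.1 + w y) := by gcongr; exact le_abs_self C
      _ ≤ _ := by gcongr
  refine eventually_lt_riskAt_seq hσ h0 h1 h2 hp
    (f := fun k y => M.c (z k).1.1 (z k).1.2 y + v y) (B := fun y => |C| * (n + w y) + |v y|)
    (fun k => (h3.memLp hwp (z k)).add hv) (fun k => (h3.measurable_section _ _).add hvm)
    ((h3.memLp hwp z₀).add hv) ((h3.measurable_section _ _).add hvm)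
    ((((memLp_const n).add hwp).const_mul |C|).add hv.abs)
    (fun k y => neg_le_of_abs_le (hb _ (hwz k) y))
    (hb _ hwz₀) (fun y b hb => ?_) hz ha
  have h4 : b - v y < M.c z₀.1.1 z₀.1.2 y := sub_lt_iff_lt_add.2 hb
  have h5 := ((continuous_subtype_val.tendsto z₀).comp hz).eventually (h3.lsc y z₀.1 _ h4)
  filter_upwards [h5] with k hk
  have hk' : b - v y < M.c (z k).1.1 (z k).1.2 y := hk
  linarith

omit hW in
/-- The set of states at which some control in a closed set has a Bellman value at most `q`. -/
theorem measurableSet_exists_bellman_le (h1 : M.G1 p P0) (h2 : G2 σ) (h4 : M.G4) (hp : p ≠ ∞)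
    (hwm : Measurable w) {v : X → ℝ} (hvm : Measurable v) (hv : MemLp v p P0) {F : Set A}
    (hF : IsClosed F) (q : ℝ) :
    MeasurableSet {x | ∃ (u : A) (hu : u ∈ M.U x), u ∈ F ∧ M.bellman σ h0 v ⟨(x, u), hu⟩ ≤ q} := by
  let E : ℕ → Set (X × A) := fun n =>
    {s | ∃ hu : s.2 ∈ M.U s.1, s.2 ∈ F ∧ w s.1 ≤ n ∧ M.bellman σ h0 v ⟨s, hu⟩ ≤ q}
  have heq : {x | ∃ (u : A) (hu : u ∈ M.U x), u ∈ F ∧ M.bellman σ h0 v ⟨(x, u), hu⟩ ≤ q} =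
      ⋃ n : ℕ, {x | w x ≤ n} ∩ {x | ∃ u ∈ M.U x, (x, u) ∈ closure (E n)} := by
    ext x
    simp only [Set.mem_ofPred_eq, Set.mem_iUnion, Set.mem_inter_iff]
    constructor
    · rintro ⟨u, hu, huF, hq⟩
      obtain ⟨n, hn⟩ := exists_nat_ge (w x)
      exact ⟨n, hn, u, hu, subset_closure ⟨hu, huF, hn, hq⟩⟩
    · rintro ⟨n, hn, u, hu, hcl⟩
      obtain ⟨s, hs, hlim⟩ := mem_closure_iff_seq_limit.1 hcl
      choose hsU hsF hsw hsq using hs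
      have hz : Tendsto (fun k => (⟨s k, hsU k⟩ : M.Graph)) atTop (𝓝 ⟨(x, u), hu⟩) :=
        tendsto_subtype_rng.2 hlim
      refine ⟨u, hu, hF.mem_of_tendsto ((continuous_snd.tendsto _).comp hlim)
        (Eventually.of_forall hsF), ?_⟩
      by_contra! hlt
      obtain ⟨k, hk⟩ := (eventually_lt_bellman hσ h0 hw1 hwp h3 h1 h2 hp hvm hv hz hsw hn
        hlt).exists
      exact absurd (hsq k) (not_le.2 hk)
  rw [heq]
  exact MeasurableSet.iUnion fun n => (measurableSet_le hwm measurable_const).inter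
    (measurableSet_exists_mem_of_isClosed h4 M.U_measurable isClosed_closure)

omit hW in
/-- Measurable selection of optimal controls in the dynamic programming equation. -/
theorem exists_isMinimizer (h1 : M.G1 p P0) (h2 : G2 σ) (h4 : M.G4) (hp : p ≠ ∞)
    (hwm : Measurable w) {v : X → ℝ} (hvm : Measurable v) (hv : MemLp v p P0) :
    ∃ π : M.DecisionRule, M.IsMinimizer σ h0 v π := by
  classical
  -- Outside the control sets the value `0` is irrelevant.
  let φ : X → A → ℝ := fun x u =>
    if hu : u ∈ M.U x then M.bellman σ h0 v ⟨(x, u), hu⟩ else 0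
  have hφ : ∀ x u (hu : u ∈ M.U x), φ x u = M.bellman σ h0 v ⟨(x, u), hu⟩ := fun x u hu =>
    dif_pos hu
  have hU := isMeasurableCompactMultifunction_of_isOpen M.U_nonempty h4 M.U_measurable
  have hlsc : ∀ x, LowerSemicontinuousOn (φ x) (M.U x) := by
    intro x u hu a ha
    rw [hφ x u hu] at ha
    rw [nhdsWithin_eq_map_subtype_coe hu, eventually_map, eventually_iff_seq_eventually]
    intro s hs
    have hz : Tendsto (fun k => (⟨(x, s k), (s k).2⟩ : M.Graph)) atTop (𝓝 ⟨(x, u), hu⟩) :=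
      tendsto_subtype_rng.2 (Tendsto.prodMk_nhds tendsto_const_nhds (tendsto_subtype_rng.1 hs))
    filter_upwards [eventually_lt_bellman hσ h0 hw1 hwp h3 h1 h2 hp hvm hv (n := w x) hz
      (fun _ => le_rfl) le_rfl ha] with k hk
    rwa [hφ x _ (s k).2]
  have hm : ∀ F : Set A, IsClosed F → ∀ q : ℝ,
      MeasurableSet {x | (M.U x ∩ (F ∩ {a | φ x a ≤ q})).Nonempty} := by
    intro F hF q
    convert measurableSet_exists_bellman_le hσ h0 hw1 hwp h3 h1 h2 h4 hp hwm hvm hv hF q using 3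
      with x
    constructor
    · rintro ⟨u, hu, huF, hq⟩
      exact ⟨u, hu, huF, hφ x u hu ▸ hq⟩
    · rintro ⟨u, hu, huF, hq⟩
      exact ⟨u, hu, huF, (hφ x u hu).trans_le hq⟩
  obtain ⟨f, hf, hfΓ⟩ := (hU.argminOn_of_lsc hlsc hm).exists_selector
  refine ⟨⟨f, hf, fun x => (hfΓ x).1⟩, fun x u => ?_⟩
  have := (hfΓ x).2 u.1 u.2
  rwa [hφ x _ u.2, hφ x _ (hfΓ x).1] at this

end Bellman

/-! ### Value iteration -/

section ValueIteration

set_option linter.unusedSectionVars false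

variable {X A : Type*} [TopologicalSpace X] [TopologicalSpace.MetrizableSpace X]
  [SecondCountableTopology X] [MeasurableSpace X] [BorelSpace X] [StandardBorelSpace X]
  [TopologicalSpace A] [TopologicalSpace.MetrizableSpace A] [SecondCountableTopology A]
  [MeasurableSpace A] [BorelSpace A]
  {M : ControlledModel X A} {p : ℝ≥0∞} [Fact (1 ≤ p)] {P0 : Measure X} [IsProbabilityMeasure P0]
  {σ : Lp ℝ p P0 → X → DualProb p P0 → ℝ} {w : X → ℝ}

/-- A minimizing rule attains the value in the dynamic programming equation. -/
theorem SolvesDP.eq_bellman {h0 : M.G0 p P0} {v : X → ℝ} (hv : M.SolvesDP σ h0 v)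
    {π : M.DecisionRule} (hπ : M.IsMinimizer σ h0 v π) (x : X) :
    v x = M.bellman σ h0 v (π.pair x) := by
  have hleast : IsLeast (Set.range fun u : M.U x => M.bellman σ h0 v ⟨(x, u.1), u.2⟩)
      (M.bellman σ h0 v (π.pair x)) := by
    refine ⟨⟨⟨π.toFun x, π.feasible x⟩, rfl⟩, ?_⟩
    rintro _ ⟨u, rfl⟩
    exact hπ x u
  exact (hv.1 x).unique hleast.isGLB

variable (hσ : IsRiskTransition σ) (h0 : M.G0 p P0) (hw1 : ∀ x, 1 ≤ w x) (hwp : MemLp w p P0)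
  (h3 : M.G3 w) {θ : ℝ} {W : X → ℝ} (hW : IsContractiveWeight M σ h0 w θ W)
  (h1 : M.G1 p P0) (h2 : G2 σ) (h4 : M.G4) (hp : p ≠ ∞) (hwm : Measurable w)

include hσ hw1 hwp h3 h1 h2 h4 hp hwm

/-- A solution of the dynamic programming equation is measurable, being a minimum of Bellman values,
which depend on it only through its class. -/
theorem SolvesDP.measurable {v : X → ℝ} (hvp : MemLp v p P0) (hv : M.SolvesDP σ h0 v) :
    Measurable v := by
  set v' : X → ℝ := hvp.1.mk v with hv'
  have hae : v =ᵐ[P0] v' := hvp.1.ae_eq_mk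
  have hvm' : Measurable v' := hvp.1.stronglyMeasurable_mk.measurable
  have hvp' : MemLp v' p P0 := (memLp_congr_ae hae).1 hvp
  have hb : ∀ z : M.Graph, M.bellman σ h0 v z = M.bellman σ h0 v' z := by
    intro z
    have : (fun y => M.c z.1.1 z.1.2 y + v y) =ᵐ[P0] fun y => M.c z.1.1 z.1.2 y + v' y := by
      filter_upwards [hae] with y hy
      rw [hy]
    simp only [bellman, riskAt, toV_congr this]
  obtain ⟨π, hπ⟩ := exists_isMinimizer hσ h0 hw1 hwp h3 h1 h2 h4 hp hwm hvm' hvp'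
  have hπ' : M.IsMinimizer σ h0 v π := fun x u => by
    rw [hb, hb]
    exact hπ x u
  have heq : v = fun x => M.bellman σ h0 v' (π.pair x) := by
    funext x
    rw [← hb]
    exact hv.eq_bellman hπ' x
  rw [heq]
  refine measurable_riskAt hσ h0 h1 hp (F := fun x y => M.c x (π.toFun x) y + v' y) ?_
    (fun x => (h3.memLp hwp (π.pair x)).add hvp') (measurable_pair π)
  exact (h3.measurable_pair (measurable_pair π)).add (hvm'.comp measurable_snd)

include hW

/-- Value iteration converges geometrically to a solution of the dynamic programming equation. -/
theorem exists_solvesDP : ∃ v : X → ℝ, Measurable v ∧ BoundedBy W v ∧ M.SolvesDP σ h0 v := by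
  obtain ⟨C₀, hC0, hC⟩ := exists_riskAt_cost_add_le hσ h0 hw1 hwp h3 hW
  have hθ0 := hW.nonneg_factor
  have hθ1 := hW.factor_lt_one
  have hstep : ∀ f : {f : X → ℝ // Measurable f ∧ BoundedBy W f},
      ∃ g : {g : X → ℝ // Measurable g ∧ BoundedBy W g}, ∃ π : M.DecisionRule,
        M.IsMinimizer σ h0 f.1 π ∧ ∀ x, g.1 x = M.bellman σ h0 f.1 (π.pair x) := by
    rintro ⟨f, hfm, hfb⟩
    have hfp := hfb.memLp hfm hW.memLp
    obtain ⟨π, hπ⟩ := exists_isMinimizer hσ h0 hw1 hwp h3 h1 h2 h4 hp hwm hfm hfp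
    refine ⟨⟨fun x => M.bellman σ h0 f (π.pair x), ?_, ?_⟩, π, hπ, fun x => rfl⟩
    · refine measurable_riskAt hσ h0 h1 hp (F := fun x y => M.c x (π.toFun x) y + f y) ?_
        (fun x => (h3.memLp hwp (π.pair x)).add hfp) (measurable_pair π)
      exact (h3.measurable_pair (measurable_pair π)).add (hfm.comp measurable_snd)
    · obtain ⟨a, ha, hfa⟩ := hfb
      exact ⟨C₀ + a * θ, by positivity, fun x => hC (π.pair x) f a ha hfm hfa⟩
  choose D π hπ hD using hstep
  let V : ℕ → {f : X → ℝ // Measurable f ∧ BoundedBy W f} := fun n =>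
    Nat.rec ⟨0, measurable_zero, 0, le_rfl, by simp⟩ (fun _ f => D f) n
  have hVsucc : ∀ n x, (V (n + 1)).1 x = M.bellman σ h0 (V n).1 ((π (V n)).pair x) :=
    fun n x => hD (V n) x
  have hVp : ∀ n, MemLp (V n).1 p P0 := fun n => (V n).2.2.memLp (V n).2.1 hW.memLp
  have hone : ∀ n, ∀ x, |(V n).1 x - (V (n + 1)).1 x| ≤ C₀ * θ ^ n * W x := by
    intro n
    induction n with
    | zero =>
      intro x
      have h5 : |(V 1).1 x| ≤ (C₀ + 0 * θ) * W x := by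
        rw [show (V 1).1 x = _ from hVsucc 0 x]
        exact hC ((π (V 0)).pair x) (V 0).1 0 le_rfl (V 0).2.1 fun y => by simp [V]
      have h6 : (V 0).1 x = 0 := rfl
      rw [h6, zero_sub, abs_neg]
      simpa using h5
    | succ n ih =>
      have ha : 0 ≤ C₀ * θ ^ n := by positivity
      intro x
      rw [abs_sub_le_iff]
      constructor
      · have h5 := riskAt_cost_add_le hσ h0 hw1 hwp h3 hW (hVp n) (hVp (n + 1)) ha
          (fun y => by linarith [le_of_abs_le (ih y)]) ((π (V (n + 1))).pair x)
        have h6 := hπ (V n) x ⟨(π (V (n + 1))).toFun x, (π (V (n + 1))).feasible x⟩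
        rw [hVsucc n x, hVsucc (n + 1) x]
        have h7 : M.bellman σ h0 (V n).1 ((π (V (n + 1))).pair x) ≤
          M.bellman σ h0 (V (n + 1)).1 ((π (V (n + 1))).pair x) + C₀ * θ ^ n * θ * W x := h5
        have h8 : C₀ * θ ^ (n + 1) * W x = C₀ * θ ^ n * θ * W x := by ring
        exact sub_le_iff_le_add'.2 (by rw [h8]; exact h6.trans h7)
      · have h5 := riskAt_cost_add_le hσ h0 hw1 hwp h3 hW (hVp (n + 1)) (hVp n) ha
          (fun y => by linarith [neg_le_of_abs_le (ih y)]) ((π (V n)).pair x)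
        have h6 := hπ (V (n + 1)) x ⟨(π (V n)).toFun x, (π (V n)).feasible x⟩
        rw [hVsucc n x, hVsucc (n + 1) x]
        have h7 : M.bellman σ h0 (V (n + 1)).1 ((π (V n)).pair x) ≤
          M.bellman σ h0 (V n).1 ((π (V n)).pair x) + C₀ * θ ^ n * θ * W x := h5
        have h8 : C₀ * θ ^ (n + 1) * W x = C₀ * θ ^ n * θ * W x := by ring
        exact sub_le_iff_le_add'.2 (by rw [h8]; exact h6.trans h7)
  have hdist : ∀ x n, dist ((V n).1 x) ((V (n + 1)).1 x) ≤ C₀ * W x * θ ^ n := fun x n => by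
    rw [Real.dist_eq]
    exact (hone n x).trans_eq (by ring)
  choose v hlim using fun x => cauchySeq_tendsto_of_complete
    (cauchySeq_of_le_geometric θ (C₀ * W x) hθ1 (hdist x))
  have herr : ∀ n x, |(V n).1 x - v x| ≤ C₀ * θ ^ n / (1 - θ) * W x := fun n x => by
    have h5 := dist_le_of_le_geometric_of_tendsto θ (C₀ * W x) hθ1 (hdist x) (hlim x) n
    rw [Real.dist_eq] at h5
    exact h5.trans_eq (by ring)
  have hvm : Measurable v :=
    measurable_of_tendsto_metrizable (fun n => (V n).2.1) (tendsto_pi_nhds.2 hlim)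
  have h1θ : 0 < 1 - θ := sub_pos.2 hθ1
  have hvb : BoundedBy W v := by
    refine ⟨C₀ / (1 - θ), by positivity, fun x => ?_⟩
    have h5 := herr 0 x
    have h6 : (V 0).1 x = 0 := rfl
    rw [h6, zero_sub, abs_neg] at h5
    simpa using h5
  have hvp := hvb.memLp hvm hW.memLp
  refine ⟨v, hvm, hvb, fun x => ?_, hvb.apply_xA hW hw1⟩
  have hsmall : Tendsto (fun n : ℕ => C₀ * θ ^ n / (1 - θ) * θ * W x) atTop (𝓝 0) := by
    simpa using ((((tendsto_pow_atTop_nhds_zero_of_lt_one hθ0 hθ1).const_mul C₀).div_const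
      (1 - θ)).mul_const θ).mul_const (W x)
  have ha : ∀ n : ℕ, 0 ≤ C₀ * θ ^ n / (1 - θ) := fun n => by positivity
  have hlim' : Tendsto (fun n => (V (n + 1)).1 x) atTop (𝓝 (v x)) :=
    (tendsto_add_atTop_iff_nat 1).2 (hlim x)
  have hlow : ∀ u : M.U x, v x ≤ M.bellman σ h0 v ⟨(x, u.1), u.2⟩ := by
    intro u
    refine le_of_tendsto_of_tendsto' hlim'
      (by simpa using hsmall.const_add (M.bellman σ h0 v ⟨(x, u.1), u.2⟩)) fun n => ?_
    rw [hVsucc]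
    exact (hπ (V n) x u).trans (riskAt_cost_add_le hσ h0 hw1 hwp h3 hW (hVp n) hvp (ha n)
      (fun y => by linarith [le_of_abs_le (herr n y)]) ⟨(x, u.1), u.2⟩)
  refine ⟨?_, fun b hb => ?_⟩
  · rintro _ ⟨u, rfl⟩
    exact hlow u
  · refine ge_of_tendsto' (by simpa using hlim'.add hsmall) fun n => ?_
    have h5 := riskAt_cost_add_le hσ h0 hw1 hwp h3 hW hvp (hVp n) (ha n)
      (fun y => by linarith [neg_le_of_abs_le (herr n y)]) ((π (V n)).pair x)
    have h6 : b ≤ M.bellman σ h0 v ((π (V n)).pair x) :=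
      hb ⟨⟨(π (V n)).toFun x, (π (V n)).feasible x⟩, rfl⟩
    rw [hVsucc]
    exact h6.trans h5

end ValueIteration

/-! ### Nested risks of policies -/

section Policies

set_option linter.unusedSectionVars false

variable {X A : Type*} [TopologicalSpace X] [TopologicalSpace.MetrizableSpace X]
  [SecondCountableTopology X] [MeasurableSpace X] [BorelSpace X] [StandardBorelSpace X]
  [TopologicalSpace A] [TopologicalSpace.MetrizableSpace A] [SecondCountableTopology A]
  [MeasurableSpace A] [BorelSpace A]
  {M : ControlledModel X A} {p : ℝ≥0∞} [Fact (1 ≤ p)] {P0 : Measure X} [IsProbabilityMeasure P0]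
  {σ : Lp ℝ p P0 → X → DualProb p P0 → ℝ} {w : X → ℝ}

theorem Policy.measurable_pair (Λ : M.Policy) (t : ℕ) : Measurable (Λ.pair t) :=
  (measurable_snd.prodMk (Λ.measurable t)).subtype_mk

theorem Policy.measurable_next (Λ : M.Policy) (t : ℕ) :
    Measurable fun q : M.Hist t × X => Λ.next t q.1 q.2 := by
  refine Measurable.prodMk (measurable_pi_iff.2 fun i => ?_) measurable_snd
  refine Fin.lastCases ?_ (fun i => ?_) i
  · simp only [Fin.snoc_last]
    exact (Λ.measurable_pair t).comp measurable_fst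
  · simp only [Fin.snoc_castSucc]
    exact (measurable_pi_apply i).comp (measurable_fst.comp measurable_fst)

theorem Policy.lastCost_next (Λ : M.Policy) (t : ℕ) (h : M.Hist t) (y : X) :
    M.lastCost t (Λ.next t h y) = M.c h.2 (Λ.rule t h) y := by
  simp [lastCost, Policy.next, Policy.pair]

theorem tailRisk_succ (h0 : M.G0 p P0) (Λ : M.Policy) (n t : ℕ) (h : M.Hist t) :
    M.tailRisk σ h0 Λ (n + 1) t h = M.riskAt σ h0 (fun y =>
      M.c (Λ.pair t h).1.1 (Λ.pair t h).1.2 y +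
        M.tailRisk σ h0 Λ n (t + 1) (Λ.next t h y)) (Λ.pair t h) := by
  simp only [tailRisk, condRisk, Policy.lastCost_next]
  rfl

variable (hσ : IsRiskTransition σ) (h0 : M.G0 p P0) (hw1 : ∀ x, 1 ≤ w x) (hwp : MemLp w p P0)
  (h3 : M.G3 w) {θ : ℝ} {W : X → ℝ} (hW : IsContractiveWeight M σ h0 w θ W)
  (h1 : M.G1 p P0) (hp : p ≠ ∞)

include hσ hw1 hwp h3 h1 hp hW

theorem tailRisk_measurable_bounded (Λ : M.Policy) (n : ℕ) : ∀ t : ℕ,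
    Measurable (M.tailRisk σ h0 Λ n t) ∧
      ∃ a : ℝ, 0 ≤ a ∧ ∀ h, |M.tailRisk σ h0 Λ n t h| ≤ a * W h.2 := by
  obtain ⟨C₀, hC0, hC⟩ := exists_riskAt_cost_add_le hσ h0 hw1 hwp h3 hW
  induction n with
  | zero => exact fun t => ⟨measurable_const, 0, le_rfl, fun h => by simp [tailRisk]⟩
  | succ n ih =>
    intro t
    obtain ⟨hm, a, ha, hb⟩ := ih (t + 1)
    have hm' : Measurable fun q : M.Hist t × X =>
        M.tailRisk σ h0 Λ n (t + 1) (Λ.next t q.1 q.2) := hm.comp (Λ.measurable_next t)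
    have hsec : ∀ h, Measurable fun y => M.tailRisk σ h0 Λ n (t + 1) (Λ.next t h y) := fun h =>
      hm'.comp (measurable_const.prodMk measurable_id)
    have hbd : ∀ h y, |M.tailRisk σ h0 Λ n (t + 1) (Λ.next t h y)| ≤ a * W y := fun h y =>
      hb (Λ.next t h y)
    constructor
    · have h5 : M.tailRisk σ h0 Λ (n + 1) t = fun h => M.riskAt σ h0 (fun y =>
          M.c (Λ.pair t h).1.1 (Λ.pair t h).1.2 y +
            M.tailRisk σ h0 Λ n (t + 1) (Λ.next t h y)) (Λ.pair t h) :=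
        funext fun h => tailRisk_succ h0 Λ n t h
      rw [h5]
      refine measurable_riskAt hσ h0 h1 hp (F := fun h y => M.c (Λ.pair t h).1.1
        (Λ.pair t h).1.2 y + M.tailRisk σ h0 Λ n (t + 1) (Λ.next t h y)) ?_
        (fun h => (h3.memLp hwp _).add (BoundedBy.memLp ⟨a, ha, hbd h⟩ (hsec h) hW.memLp))
        (Λ.measurable_pair t)
      exact (h3.measurable_pair (Λ.measurable_pair t)).add hm'
    · have := hW.nonneg_factor
      refine ⟨C₀ + a * θ, by positivity, fun h => ?_⟩
      rw [tailRisk_succ]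
      exact hC (Λ.pair t h) _ a ha (hsec h) (hbd h)

theorem tailRisk_section_memLp (Λ : M.Policy) (n t : ℕ) (h : M.Hist t) :
    MemLp (fun y => M.tailRisk σ h0 Λ n (t + 1) (Λ.next t h y)) p P0 := by
  obtain ⟨hm, a, ha, hb⟩ := tailRisk_measurable_bounded hσ h0 hw1 hwp h3 hW h1 hp Λ n (t + 1)
  exact BoundedBy.memLp ⟨a, ha, fun y => hb (Λ.next t h y)⟩
    ((hm.comp (Λ.measurable_next t)).comp (measurable_const.prodMk measurable_id)) hW.memLp

/-- A subsolution of the dynamic programming equation is a lower bound for the nested risks of every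
policy, up to a geometrically vanishing error. -/
theorem le_tailRisk_add {v : X → ℝ} (hvp : MemLp v p P0) {a : ℝ} (ha : 0 ≤ a)
    (hva : ∀ x, |v x| ≤ a * W x) (hsub : ∀ z : M.Graph, v z.1.1 ≤ M.bellman σ h0 v z)
    (Λ : M.Policy) (n : ℕ) : ∀ (t : ℕ) (h : M.Hist t),
      v h.2 ≤ M.tailRisk σ h0 Λ n t h + a * θ ^ n * W h.2 := by
  have := hW.nonneg_factor
  induction n with
  | zero =>
    intro t h
    simpa [tailRisk] using le_of_abs_le (hva h.2)
  | succ n ih =>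
    intro t h
    have h5 := riskAt_cost_add_le hσ h0 hw1 hwp h3 hW hvp
      (tailRisk_section_memLp hσ h0 hw1 hwp h3 hW h1 hp Λ n t h) (a := a * θ ^ n) (by positivity)
      (fun y => ih (t + 1) (Λ.next t h y)) (Λ.pair t h)
    rw [← tailRisk_succ] at h5
    exact (hsub (Λ.pair t h)).trans (h5.trans_eq (by rw [pow_succ, ← mul_assoc]; rfl))

/-- The nested risks of a stationary policy approach the solution of its evaluation equation
geometrically. -/
theorem tailRisk_stationary_le {v : X → ℝ} (hvp : MemLp v p P0) {a : ℝ} (ha : 0 ≤ a)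
    (hva : ∀ x, |v x| ≤ a * W x) {π : M.DecisionRule}
    (hsup : ∀ x, M.bellman σ h0 v (π.pair x) ≤ v x) (n : ℕ) : ∀ (t : ℕ) (h : M.Hist t),
      M.tailRisk σ h0 (stationary π) n t h ≤ v h.2 + a * θ ^ n * W h.2 := by
  have := hW.nonneg_factor
  induction n with
  | zero =>
    intro t h
    have := neg_le_of_abs_le (hva h.2)
    simp only [tailRisk, pow_zero, mul_one]
    linarith
  | succ n ih =>
    intro t h
    have h5 := riskAt_cost_add_le hσ h0 hw1 hwp h3 hW
      (tailRisk_section_memLp hσ h0 hw1 hwp h3 hW h1 hp (stationary π) n t h) hvp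
      (a := a * θ ^ n) (by positivity)
      (fun y => ih (t + 1) ((stationary π).next t h y)) ((stationary π).pair t h)
    rw [← tailRisk_succ] at h5
    refine h5.trans ?_
    rw [pow_succ, ← mul_assoc]
    exact add_le_add_left (hsup h.2) _

end Policies

/-! ### Optimality -/

section Optimality

set_option linter.unusedSectionVars false

variable {X A : Type*} [TopologicalSpace X] [TopologicalSpace.MetrizableSpace X]
  [SecondCountableTopology X] [MeasurableSpace X] [BorelSpace X] [StandardBorelSpace X]
  [TopologicalSpace A] [TopologicalSpace.MetrizableSpace A] [SecondCountableTopology A]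
  [MeasurableSpace A] [BorelSpace A]
  {M : ControlledModel X A} {p : ℝ≥0∞} [Fact (1 ≤ p)] {P0 : Measure X} [IsProbabilityMeasure P0]
  {σ : Lp ℝ p P0 → X → DualProb p P0 → ℝ} {w : X → ℝ}

theorem stationary_isMarkov (π : M.DecisionRule) : (stationary π).IsMarkov :=
  ⟨fun _ => π, fun _ _ => rfl⟩

variable (hσ : IsRiskTransition σ) (h0 : M.G0 p P0) (hw1 : ∀ x, 1 ≤ w x) (hwp : MemLp w p P0)
  (h3 : M.G3 w) {θ : ℝ} {W : X → ℝ} (hW : IsContractiveWeight M σ h0 w θ W)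
  (h1 : M.G1 p P0) (hp : p ≠ ∞)

include hσ hw1 hwp h3 h1 hp hW

theorem tendsto_J_stationary {v : X → ℝ} (hvm : Measurable v) (hvb : BoundedBy W v)
    (hv : M.SolvesDP σ h0 v) {π : M.DecisionRule} (hπ : M.IsMinimizer σ h0 v π) (x : X) :
    Tendsto (fun T => M.J σ h0 (stationary π) T x) atTop (𝓝 (v x)) := by
  have hvp := hvb.memLp hvm hW.memLp
  obtain ⟨a, ha, hva⟩ := hvb
  have hsmall : Tendsto (fun n : ℕ => a * θ ^ n * W x) atTop (𝓝 0) := by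
    simpa using ((tendsto_pow_atTop_nhds_zero_of_lt_one hW.nonneg_factor
      hW.factor_lt_one).const_mul a).mul_const (W x)
  refine tendsto_of_tendsto_of_tendsto_of_le_of_le
    (g := fun n : ℕ => v x - a * θ ^ n * W x) (h := fun n : ℕ => v x + a * θ ^ n * W x)
    (by simpa using hsmall.const_sub (v x)) (by simpa using hsmall.const_add (v x))
    (fun T => ?_) (fun T => ?_)
  · have := le_tailRisk_add hσ h0 hw1 hwp h3 hW h1 hp hvp ha hva
      (fun z => (hv.1 z.1.1).1 ⟨⟨z.1.2, z.2⟩, rfl⟩) (stationary π) T 0 (Fin.elim0, x)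
    exact sub_le_iff_le_add.2 this
  · exact tailRisk_stationary_le hσ h0 hw1 hwp h3 hW h1 hp hvp ha hva
      (fun x => (hv.eq_bellman hπ x).ge) T 0 (Fin.elim0, x)

theorem le_Jinf {v : X → ℝ} (hvm : Measurable v) (hvb : BoundedBy W v)
    (hv : M.SolvesDP σ h0 v) (Λ : M.Policy) (x : X) : (v x : EReal) ≤ M.Jinf σ h0 Λ x := by
  have hvp := hvb.memLp hvm hW.memLp
  obtain ⟨a, ha, hva⟩ := hvb
  have hsmall : Tendsto (fun n : ℕ => v x - a * θ ^ n * W x) atTop (𝓝 (v x)) := by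
    simpa using (((tendsto_pow_atTop_nhds_zero_of_lt_one hW.nonneg_factor
      hW.factor_lt_one).const_mul a).mul_const (W x)).const_sub (v x)
  have h5 : Tendsto (fun n : ℕ => ((v x - a * θ ^ n * W x : ℝ) : EReal)) atTop (𝓝 (v x : EReal)) :=
    (continuous_coe_real_ereal.tendsto _).comp hsmall
  rw [← h5.liminf_eq]
  refine liminf_le_liminf (Eventually.of_forall fun T => EReal.coe_le_coe_iff.2 ?_)
  have := le_tailRisk_add hσ h0 hw1 hwp h3 hW h1 hp hvp ha hva
      (fun z => (hv.1 z.1.1).1 ⟨⟨z.1.2, z.2⟩, rfl⟩) Λ T 0 (Fin.elim0, x)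
  exact sub_le_iff_le_add.2 this

theorem Jinf_stationary_eq {v : X → ℝ} (hvm : Measurable v) (hvb : BoundedBy W v)
    (hv : M.SolvesDP σ h0 v) {π : M.DecisionRule} (hπ : M.IsMinimizer σ h0 v π) (x : X) :
    M.Jinf σ h0 (stationary π) x = v x :=
  Tendsto.liminf_eq ((continuous_coe_real_ereal.tendsto _).comp
    (tendsto_J_stationary hσ h0 hw1 hwp h3 hW h1 hp hvm hvb hv hπ x))

theorem eq_Jopt (h2 : G2 σ) (h4 : M.G4) (hwm : Measurable w) {S : Set M.Policy}
    (hS : ∀ π : M.DecisionRule, stationary π ∈ S) {v : X → ℝ} (hvm : Measurable v)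
    (hvb : BoundedBy W v) (hv : M.SolvesDP σ h0 v) (x : X) : (v x : EReal) = M.Jopt σ h0 S x := by
  obtain ⟨π, hπ⟩ := exists_isMinimizer hσ h0 hw1 hwp h3 h1 h2 h4 hp hwm hvm
    (hvb.memLp hvm hW.memLp)
  refine le_antisymm (le_iInf₂ fun Λ _ => le_Jinf hσ h0 hw1 hwp h3 hW h1 hp hvm hvb hv Λ x) ?_
  rw [← Jinf_stationary_eq hσ h0 hw1 hwp h3 hW h1 hp hvm hvb hv hπ x]
  exact iInf₂_le _ (hS π)

end Optimality

end ControlledModel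

end

theorem theoremt {X A : Type*}
    [TopologicalSpace X] [TopologicalSpace.MetrizableSpace X] [SecondCountableTopology X]
    [MeasurableSpace X] [BorelSpace X] [StandardBorelSpace X]
    [TopologicalSpace A] [TopologicalSpace.MetrizableSpace A] [SecondCountableTopology A]
    [MeasurableSpace A] [BorelSpace A] [StandardBorelSpace A]
    (M : ControlledModel X A)
    (p : ℝ≥0∞) [Fact (1 ≤ p)] (hp : p ≠ ∞)
    (P0 : Measure X) [IsProbabilityMeasure P0]
    (w : X → ℝ) (hw_meas : Measurable w) (hw_one : ∀ x, 1 ≤ w x) (hw_memLp : MemLp w p P0)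
    (σ : Lp ℝ p P0 → X → DualProb p P0 → ℝ) (hσ : IsRiskTransition σ)
    (h0 : M.G0 p P0) (h1 : M.G1 p P0) (h2 : ControlledModel.G2 σ) (h3 : M.G3 w) (h4 : M.G4)
    (htrans : M.UniformlyRiskTransient σ h0 w)
    -- the class of policies: all deterministic policies, or all deterministic Markov policies
    (S : Set M.Policy) (hS : S = Set.univ ∨ S = {Λ | Λ.IsMarkov})
    (hJ_meas : Measurable (M.Jopt σ h0 S))
    (hJ_lower : ∃ C : ℝ, ∀ Λ ∈ S, ∀ x, ((-(C * w x) : ℝ) : EReal) ≤ M.Jinf σ h0 Λ x) :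
    (∀ v : X → ℝ, MemLp v p P0 → WBounded w v →
      (M.SolvesDP σ h0 v ↔ ∀ x, (v x : EReal) = M.Jopt σ h0 S x)) ∧
    ∃ v : X → ℝ, Measurable v ∧ MemLp v p P0 ∧ WBounded w v ∧
      (∀ x, (v x : EReal) = M.Jopt σ h0 S x) ∧ M.SolvesDP σ h0 v ∧
      (∃ π : M.DecisionRule, M.IsMinimizer σ h0 v π) ∧
      ∀ π : M.DecisionRule, M.IsMinimizer σ h0 v π →
        ControlledModel.stationary π ∈ S ∧
        ∀ x, Tendsto (fun T => M.J σ h0 (ControlledModel.stationary π) T x) atTop (𝓝 (v x)) ∧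
          M.Jinf σ h0 (ControlledModel.stationary π) x = M.Jopt σ h0 S x := by
  obtain ⟨K, hK⟩ := htrans
  obtain ⟨θ, W, hW⟩ := ControlledModel.exists_isContractiveWeight hσ h0 h1 hp hw_meas hw_one
    hw_memLp hK h2 h4
  have hstat : ∀ π : M.DecisionRule, ControlledModel.stationary π ∈ S := by
    intro π
    rcases hS with rfl | rfl
    · exact Set.mem_univ _
    · exact ControlledModel.stationary_isMarkov π
  have hopt : ∀ v : X → ℝ, Measurable v → ControlledModel.BoundedBy W v → M.SolvesDP σ h0 v →
      ∀ x, (v x : EReal) = M.Jopt σ h0 S x := fun v hvm hvb hv =>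
    ControlledModel.eq_Jopt hσ h0 hw_one hw_memLp h3 hW h1 hp h2 h4 hw_meas hstat hvm hvb hv
  obtain ⟨v₀, hm₀, hb₀, hs₀⟩ := ControlledModel.exists_solvesDP hσ h0 hw_one hw_memLp h3 hW h1 h2
    h4 hp hw_meas
  have hp₀ := hb₀.memLp hm₀ hW.memLp
  refine ⟨fun v hvp hvw => ⟨fun hv => ?_, fun hv => ?_⟩, v₀, hm₀, hp₀, hb₀.wBounded hW hw_one,
    hopt v₀ hm₀ hb₀ hs₀, hs₀, ?_, fun π hπ => ⟨hstat π, fun x => ⟨?_, ?_⟩⟩⟩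
  · exact hopt v (hv.measurable hσ h0 hw_one hw_memLp h3 h1 h2 h4 hp hw_meas hvp)
      (ControlledModel.boundedBy_of_wBounded hW hw_one hvw hv.2) hv
  · have : v = v₀ := funext fun x =>
      EReal.coe_injective ((hv x).trans (hopt v₀ hm₀ hb₀ hs₀ x).symm)
    exact this ▸ hs₀
  · exact ControlledModel.exists_isMinimizer hσ h0 hw_one hw_memLp h3 h1 h2 h4 hp hw_meas hm₀ hp₀
  · exact ControlledModel.tendsto_J_stationary hσ h0 hw_one hw_memLp h3 hW h1 hp hm₀ hb₀ hs₀ hπ x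
  · rw [← hopt v₀ hm₀ hb₀ hs₀ x]
    exact ControlledModel.Jinf_stationary_eq hσ h0 hw_one hw_memLp h3 hW h1 hp hm₀ hb₀ hs₀ hπ x
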